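/- Let $\mathfrak g$ be a finite-dimensional complex simple Lie algebra with Cartan subalgebra $\mathfrak h$, simple roots $\alpha_1,\dots,\alpha_r$, invariant form on $\mathfrak h^*$ normalized so that $(\alpha_i,\alpha_i)=2$ for short simple roots, $d_i=(\alpha_i,\alpha_i)/2$ and Cartan matrix $(a_{ij})$ given by $(\alpha_i,\alpha_j)=d_ia_{ij}$. Let $q>0$ be real, $q\neq1$, and $q_i=q^{d_i}$. Let $U_q(\mathfrak g)$ be the Hopf $*$-algebra generated by $E_i,F_i,K_i^{\pm1}$ with relations $K_iK_i^{-1}=K_i^{-1}K_i=1$, $K_iK_j=K_jK_i$, $K_iE_jK_i^{-1}=q_i^{a_{ij}}E_j$, $K_iF_jK_i^{-1}=q_i^{-a_{ij}}F_j$, $E_iF_j-F_jE_i=\delta_{ij}\frac{K_i-K_i^{-1}}{q_i-q_i^{-1}}$ and the quantum Serre relations, with $\Delta(K_i)=K_i\otimes K_i$, $\Delta(E_i)=E_i\otimes K_i+1\otimes E_i$, $\Delta(F_i)=F_i\otimes1+K_i^{-1}\otimes F_i$, $S(K_i)=K_i^{-1}$, $S(E_i)=-E_iK_i^{-1}$,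 $S(F_i)=-K_iF_i$, $\varepsilon(K_i)=1$, $\varepsilon(E_i)=\varepsilon(F_i)=0$, and $K_i^*=K_i$, $E_i^*=K_iF_i$, $F_i^*=E_iK_i^{-1}$. Let $\mathbb C_q[G]\subset U_q(\mathfrak g)^*$ be the span of the matrix coefficients of finite-dimensional (type 1) representations of $U_q(\mathfrak g)$, with product $(\phi\psi)(X)=(\phi\otimes\psi)(\Delta(X))$, involution $\phi^*(X)=\overline{\phi(S(X)^*)}$ and actions $(X\triangleright\phi)(Y)=\phi(YX)$, $(\phi\triangleleft X)(Y)=\phi(XY)$. For a subset $S$ of the simple roots let $U_q(\mathfrak l_S)\subset U_q(\mathfrak g)$ be the subalgebra generated by all $K_i^{\pm1}$ and by $E_i,F_i$ with $\alpha_i\in S$, and put $$\mathbb C_q[G/L_S]=\{a\in\mathbb C_q[G]: X\triangleright a=\varepsilon(X)a\ \ \forall X\in U_q(\mathfrak l_S)\},\qquad \mathbb C_q[L_S\backslash G]=\{a\in\mathbb C_q[G]: a\triangleleft X=\varepsilon(X)a\ \ \forall X\in U_q(\mathfrak l_S)\}.$$ Let $V(\Lambda)$ be the irreducible finite-dimensional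 representation with dominant integral highest weight $\Lambda$, with an inner product for which it is a $*$-representation, let $\{v_i\}$ be an orthonormal basis of it, $\{f^i\}$ the dual basis of $V(\Lambda)^*$, and $u^i_j(X)=f^i(X\triangleright v_j)$. Define matrices $\mathsf M^n_m,\mathsf N^n_m$ over $\mathbb C_q[G]$ by $(\mathsf M^n_m)^i_j=u^{m*}_iu^n_j$ and $(\mathsf N^n_m)^i_j=u^i_mu^{j*}_n$. For complex numbers $c^m_n$ put $$\mathsf P=\sum_{m,n}c^m_n\mathsf M^n_m,\qquad \mathsf Q=\sum_{m,n}c^m_n\mathsf N^n_m,\qquad w=\sum_{m,n}c^m_n\,v_m\otimes f^n\in V(\Lambda)\otimes V(\Lambda)^*,$$ where $U_q(\mathfrak g)$ acts on $V(\Lambda)^*$ by $(X\triangleright f)(v)=f(S(X)\triangleright v)$ and on the tensor product through $\Delta$. Then all $\mathsf P^i_j$ lie in $\mathbb C_q[L_S\backslash G]$ and all $\mathsf Q^i_j$ lie in $\mathbb C_q[G/L_S]$ if and only if $w$ is $U_q(\mathfrak l_S)$-invariant, i.e. $X\triangleright w=\varepsilon(X)w$ for all $X\in U_q(\mathfrak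 l_S)$. Moreover each of the two conditions, the one on $\mathsf P$ and the one on $\mathsf Q$, is by itself equivalent to the invariance of $w$. -/

import Mathlib

open scoped TensorProduct

noncomputable section

namespace QuantumFlag

/-! ### Quantum integers and binomial coefficients -/

/-- The quantum integer `[n]_t = t^(n-1) + t^(n-3) + ⋯ + t^(-(n-1))`, that is
`(t^n - t^(-n)) / (t - t⁻¹)`. -/
def qInt (t : ℝ) (n : ℕ) : ℝ :=
  ∑ k ∈ Finset.range n, t ^ ((n : ℤ) - 1 - 2 * k)

/-- The quantum factorial `[n]_t! = [1]_t [2]_t ⋯ [n]_t`. -/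
def qFactorial (t : ℝ) (n : ℕ) : ℝ :=
  ∏ k ∈ Finset.range n, qInt t (k + 1)

/-- The quantum binomial coefficient `[n]_t! / ([r]_t! [n-r]_t!)`, for `r ≤ n`. -/
def qBinom (t : ℝ) (n r : ℕ) : ℝ :=
  qFactorial t n / (qFactorial t r * qFactorial t (n - r))

theorem qInt_add {t : ℝ} (ht : 0 < t) (a b : ℕ) :
    qInt t (a + b) = t ^ (b : ℤ) * qInt t a + t ^ (-(a : ℤ)) * qInt t b := by
  unfold qInt
  rw [Finset.sum_range_add, Finset.mul_sum, Finset.mul_sum]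
  congr 1
  · refine Finset.sum_congr rfl fun k _ => ?_
    rw [← zpow_add₀ ht.ne']; congr 1; push_cast; ring
  · refine Finset.sum_congr rfl fun k _ => ?_
    rw [← zpow_add₀ ht.ne']; congr 1; push_cast; ring

theorem qInt_pos {t : ℝ} (ht : 0 < t) (n : ℕ) : 0 < qInt t (n + 1) := by
  unfold qInt
  exact Finset.sum_pos (fun k _ => zpow_pos ht _) (by simp)

theorem qFactorial_pos {t : ℝ} (ht : 0 < t) (n : ℕ) : 0 < qFactorial t n :=
  Finset.prod_pos fun k _ => qInt_pos ht k

theorem qFactorial_succ (t : ℝ) (n : ℕ) :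
    qFactorial t (n + 1) = qFactorial t n * qInt t (n + 1) := by
  simp [qFactorial, Finset.prod_range_succ]

theorem qBinom_zero_right {t : ℝ} (ht : 0 < t) (n : ℕ) : qBinom t n 0 = 1 := by
  have := (qFactorial_pos ht n).ne'
  simp only [qBinom, Nat.sub_zero]
  rw [show qFactorial t 0 = 1 by simp [qFactorial], one_mul, div_self this]

theorem qBinom_self {t : ℝ} (ht : 0 < t) (n : ℕ) : qBinom t n n = 1 := by
  have := (qFactorial_pos ht n).ne'
  simp only [qBinom, Nat.sub_self]
  rw [show qFactorial t 0 = 1 by simp [qFactorial], mul_one, div_self this]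

theorem qBinom_symm (t : ℝ) {n r : ℕ} (h : r ≤ n) : qBinom t n (n - r) = qBinom t n r := by
  simp only [qBinom, Nat.sub_sub_self h]
  rw [mul_comm (qFactorial t (n - r))]

/-- The quantum Pascal rule. -/
theorem qBinom_succ {t : ℝ} (ht : 0 < t) {n r : ℕ} (h : r < n) :
    qBinom t (n + 1) (r + 1) =
      t ^ (-((r : ℤ) + 1)) * qBinom t n (r + 1) + t ^ ((n : ℤ) - r) * qBinom t n r := by
  obtain ⟨m, rfl⟩ : ∃ m, n = r + m + 1 := ⟨n - r - 1, by omega⟩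
  have e1 : r + m + 1 + 1 - (r + 1) = m + 1 := by omega
  have e2 : r + m + 1 - (r + 1) = m := by omega
  have e3 : r + m + 1 - r = m + 1 := by omega
  simp only [qBinom, e1, e2, e3]
  have h1 := (qFactorial_pos ht (r + m + 1)).ne'
  have h2 := (qFactorial_pos ht r).ne'
  have h3 := (qFactorial_pos ht m).ne'
  have h4 := (qInt_pos ht r).ne'
  have h5 := (qInt_pos ht m).ne'
  have key := qInt_add ht (r + 1) (m + 1)
  rw [qFactorial_succ t (r + m + 1), qFactorial_succ t r, qFactorial_succ t m,
    show r + m + 1 + 1 = r + 1 + (m + 1) by ring, key,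
    show ((r + m + 1 : ℕ) : ℤ) - r = ((m + 1 : ℕ) : ℤ) by push_cast; ring,
    show (-((r : ℤ) + 1)) = -((r + 1 : ℕ) : ℤ) by push_cast; ring]
  field_simp
  ring

theorem qInt_inv (t : ℝ) (n : ℕ) : qInt t⁻¹ n = qInt t n := by
  unfold qInt
  rw [← Finset.sum_range_reflect]
  refine Finset.sum_congr rfl fun k hk => ?_
  have hk := Finset.mem_range.1 hk
  rw [inv_zpow', Nat.sub_sub, Nat.cast_sub (by omega)]
  congr 1; push_cast; ring

theorem qBinom_inv (t : ℝ) (n r : ℕ) : qBinom t⁻¹ n r = qBinom t n r := by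
  simp only [qBinom, qFactorial, qInt_inv]

/-! ### The quantum Serre expression -/

section Serre

variable {A : Type*} [Ring A] [Algebra ℂ A]

/-- The quantum Serre expression `∑_{r=0}^{n} (-1)^r [n; r]_t x^(n-r) y x^r`. -/
def serre (t : ℝ) (n : ℕ) (x y : A) : A :=
  ∑ r ∈ Finset.range (n + 1),
    (((-1) ^ r * qBinom t n r : ℝ) : ℂ) • (x ^ (n - r) * y * x ^ r)

/-- The iterated twisted commutators `z₀ = y`, `z_{s+1} = x z_s - e(s) z_s x`. -/
def iterComm (e : ℕ → ℂ) (x y : A) : ℕ → A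
  | 0 => y
  | s + 1 => x * iterComm e x y s - e s • (iterComm e x y s * x)

theorem iterComm_congr {e e' : ℕ → ℂ} (x y : A) (n : ℕ) (h : ∀ s < n, e s = e' s) :
    iterComm e x y n = iterComm e' x y n := by
  induction n with
  | zero => rfl
  | succ n ih =>
    simp only [iterComm]
    rw [ih fun s hs => h s (by omega), h n (by omega)]

theorem serre_scaled_eq_iterComm {t : ℝ} (ht : 0 < t) (x y : A) (n : ℕ) (c : ℝ) :
    ∑ r ∈ Finset.range (n + 1),
      (((-1) ^ r * qBinom t n r * c ^ r : ℝ) : ℂ) • (x ^ (n - r) * y * x ^ r) =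
    iterComm (fun s => ((c * t ^ (2 * (s : ℤ) - n + 1) : ℝ) : ℂ)) x y n := by
  induction n generalizing c with
  | zero => simp [iterComm, qBinom_self ht]
  | succ n ih =>
    have h0 := ih (c / t)
    have e1 : iterComm (fun s => ((c * t ^ (2 * (s : ℤ) - (n + 1 : ℕ) + 1) : ℝ) : ℂ)) x y n =
        iterComm (fun s => ((c / t * t ^ (2 * (s : ℤ) - n + 1) : ℝ) : ℂ)) x y n := by
      refine iterComm_congr x y n fun s _ => ?_
      congr 1
      rw [div_mul_eq_mul_div, mul_div_assoc, div_eq_mul_inv (t ^ _) t, ← zpow_sub_one₀ ht.ne']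
      congr 2; push_cast; ring
    simp only [iterComm]
    rw [e1, ← h0, Finset.mul_sum, Finset.sum_mul, Finset.smul_sum]
    rw [Finset.sum_range_succ', Finset.sum_range_succ]
    rw [Finset.sum_range_succ' (fun r => x * _), Finset.sum_range_succ (fun r => _ • (_ * x))]
    have e2 : ∀ r ∈ Finset.range n,
        (((-1) ^ (r + 1) * qBinom t (n + 1) (r + 1) * c ^ (r + 1) : ℝ) : ℂ) •
          (x ^ (n + 1 - (r + 1)) * y * x ^ (r + 1)) =
        x * ((((-1) ^ (r + 1) * qBinom t n (r + 1) * (c / t) ^ (r + 1) : ℝ) : ℂ) •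
          (x ^ (n - (r + 1)) * y * x ^ (r + 1))) -
        ((c * t ^ (2 * (n : ℤ) - (n + 1 : ℕ) + 1) : ℝ) : ℂ) •
          ((((-1) ^ r * qBinom t n r * (c / t) ^ r : ℝ) : ℂ) •
          (x ^ (n - r) * y * x ^ r) * x) := by
      intro r hr
      have hr := Finset.mem_range.1 hr
      have m1 : x * (x ^ (n - (r + 1)) * y * x ^ (r + 1)) = x ^ (n - r) * y * x ^ (r + 1) := by
        rw [← mul_assoc, ← mul_assoc, ← pow_succ', show n - (r + 1) + 1 = n - r by omega]
      have m2 : (x ^ (n - r) * y * x ^ r) * x = x ^ (n - r) * y * x ^ (r + 1) := by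
        rw [mul_assoc, ← pow_succ]
      rw [mul_smul_comm, smul_mul_assoc, m1, m2, smul_smul, ← sub_smul,
        show n + 1 - (r + 1) = n - r by omega]
      congr 1
      rw [← Complex.ofReal_mul, ← Complex.ofReal_sub]
      congr 1
      rw [qBinom_succ ht hr]
      have p1 : t ^ (-((r : ℤ) + 1)) = (t ^ (r + 1))⁻¹ := by
        rw [zpow_neg]; norm_cast
      have p2 : t ^ ((n : ℤ) - r) = t ^ n / t ^ r := by
        rw [zpow_sub₀ ht.ne']; norm_cast
      have p3 : t ^ (2 * (n : ℤ) - (n + 1 : ℕ) + 1) = t ^ n := by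
        rw [← zpow_natCast]; congr 1; push_cast; ring
      rw [p1, p2, p3, div_pow, div_pow]
      have := ht.ne'
      field_simp
      ring
    rw [Finset.sum_congr rfl e2, Finset.sum_sub_distrib]
    have e3 : x * ((((-1) ^ 0 * qBinom t n 0 * (c / t) ^ 0 : ℝ) : ℂ) •
        (x ^ (n - 0) * y * x ^ 0)) = (((-1) ^ 0 * qBinom t (n + 1) 0 * c ^ 0 : ℝ) : ℂ) •
        (x ^ (n + 1 - 0) * y * x ^ 0) := by
      simp [qBinom_zero_right ht, pow_succ', mul_assoc]
    have e4 : (((-1) ^ (n + 1) * qBinom t (n + 1) (n + 1) * c ^ (n + 1) : ℝ) : ℂ) •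
        (x ^ (n + 1 - (n + 1)) * y * x ^ (n + 1)) =
        -(((c * t ^ (2 * (n : ℤ) - (n + 1 : ℕ) + 1) : ℝ) : ℂ) •
          ((((-1) ^ n * qBinom t n n * (c / t) ^ n : ℝ) : ℂ) •
          (x ^ (n - n) * y * x ^ n) * x)) := by
      have p3 : t ^ (2 * (n : ℤ) - (n + 1 : ℕ) + 1) = t ^ n := by
        rw [← zpow_natCast]; congr 1; push_cast; ring
      rw [smul_mul_assoc, smul_smul, ← neg_smul, Nat.sub_self, Nat.sub_self, pow_zero, one_mul,
        mul_assoc y, ← pow_succ, ← Complex.ofReal_mul, ← Complex.ofReal_neg]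
      congr 2
      rw [qBinom_self ht, qBinom_self ht, p3, div_pow]
      have := ht.ne'
      field_simp
      ring
    rw [e3, e4]
    abel

theorem serre_eq_iterComm {t : ℝ} (ht : 0 < t) (x y : A) (n : ℕ) :
    serre t n x y = iterComm (fun s => ((t ^ (2 * (s : ℤ) - n + 1) : ℝ) : ℂ)) x y n := by
  have := serre_scaled_eq_iterComm ht x y n 1
  simpa [serre] using this

theorem serre_eq_iterComm' {t : ℝ} (ht : 0 < t) (x y : A) (n : ℕ) :
    serre t n x y = iterComm (fun s => ((t ^ (-(2 * (s : ℤ) - n + 1)) : ℝ) : ℂ)) x y n := by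
  have h := serre_eq_iterComm (inv_pos.2 ht) x y n
  rw [show serre t⁻¹ n x y = serre t n x y by simp only [serre, qBinom_inv]] at h
  rw [h]
  refine iterComm_congr x y n fun s _ => ?_
  rw [inv_zpow']

theorem serre_add_right (t : ℝ) (n : ℕ) (x y y' : A) :
    serre t n x (y + y') = serre t n x y + serre t n x y' := by
  simp only [serre, mul_add, add_mul, smul_add, Finset.sum_add_distrib]

theorem serre_zero (t : ℝ) (n : ℕ) (x : A) : serre t n x 0 = 0 := by
  simp [serre]

theorem map_serre {B : Type*} [Ring B] [Algebra ℂ B] (f : A →ₐ[ℂ] B) (t : ℝ) (n : ℕ) (x y : A) :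
    f (serre t n x y) = serre t n (f x) (f y) := by
  simp [serre]

/-- Adding to `x` an element that commutes up to the right scalars. -/
theorem iterComm_add (e : ℕ → ℂ) (x a y : A) (u w : ℂ) (hx : a * x = u • (x * a))
    (hy : a * y = w • (y * a)) (he : ∀ s, e s = w * u ^ s) (n : ℕ) :
    iterComm e (x + a) y n = iterComm e x y n ∧
      a * iterComm e x y n = (w * u ^ n) • (iterComm e x y n * a) := by
  induction n with
  | zero => simpa [iterComm] using hy
  | succ n ih =>
    obtain ⟨h1, h2⟩ := ih
    set z := iterComm e x y n with hz
    refine ⟨?_, ?_⟩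
    · simp only [iterComm]
      rw [h1, add_mul, mul_add, h2, he, smul_add]
      abel
    · simp only [iterComm]
      rw [← hz, mul_sub, ← mul_assoc, hx, mul_smul_comm, ← mul_assoc a, h2, smul_mul_assoc,
        smul_mul_assoc, mul_assoc x, h2, mul_assoc z, hx, sub_mul, mul_smul_comm, mul_smul_comm,
        smul_sub, smul_mul_assoc]
      simp only [smul_smul, mul_assoc]
      congr 2
      · ring
      · ring

/-- Multiplying `x` and `y` by commuting elements that commute with them up to scalars. -/
theorem iterComm_twist (e : ℕ → ℂ) (x y k l : A) (u w : ℂ) (hkl : k * l = l * k)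
    (hxk : x * k = u • (k * x)) (hxl : x * l = w • (l * x)) (hyk : y * k = w • (k * y)) (n : ℕ) :
    (∃ κ : ℂ, iterComm e (k * x) (l * y) n = κ • (k ^ n * l * iterComm e x y n)) ∧
      iterComm e x y n * k = (w * u ^ n) • (k * iterComm e x y n) ∧
      x * (k ^ n * l) = (w * u ^ n) • (k ^ n * l * x) := by
  induction n with
  | zero =>
    refine ⟨⟨1, by simp [iterComm]⟩, by simpa [iterComm] using hyk, by simpa using hxl⟩
  | succ n ih =>
    obtain ⟨⟨κ, h1⟩, h2, h3⟩ := ih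
    set z := iterComm e x y n with hz
    refine ⟨⟨κ * (w * u ^ n), ?_⟩, ?_, ?_⟩
    · simp only [iterComm]
      rw [h1, ← hz]
      have a1 : k * x * (k ^ n * l * z) = (w * u ^ n) • (k ^ (n + 1) * l * (x * z)) := by
        rw [mul_assoc k, ← mul_assoc x, h3, smul_mul_assoc, mul_smul_comm, pow_succ']
        simp only [mul_assoc]
      have a2 : k ^ n * l * z * (k * x) = (w * u ^ n) • (k ^ (n + 1) * l * (z * x)) := by
        rw [mul_assoc (k ^ n * l), ← mul_assoc z, h2, smul_mul_assoc, mul_smul_comm, pow_succ]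
        congr 1
        rw [mul_assoc (k ^ n) k l, hkl]
        simp only [mul_assoc]
      rw [mul_smul_comm, smul_mul_assoc, a1, a2, mul_sub, smul_sub, mul_smul_comm]
      simp only [smul_smul]
      congr 2
      ring
    · simp only [iterComm]
      rw [← hz, sub_mul, mul_assoc, h2, smul_mul_assoc, mul_assoc z, hxk, mul_smul_comm,
        mul_smul_comm, ← mul_assoc x, hxk, ← mul_assoc z, h2, mul_sub, smul_sub, mul_smul_comm]
      simp only [smul_mul_assoc, smul_smul, mul_assoc]
      congr 2
      all_goals ring
    · rw [pow_succ', mul_assoc k, ← mul_assoc x, hxk, smul_mul_assoc, mul_assoc k, h3,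
        mul_smul_comm, smul_smul, ← mul_assoc k]
      congr 1
      ring

theorem serre_twist {t : ℝ} (ht : 0 < t) (n : ℕ) (x y k l : A) (u w : ℂ) (hkl : k * l = l * k)
    (hxk : x * k = u • (k * x)) (hxl : x * l = w • (l * x)) (hyk : y * k = w • (k * y))
    (h : serre t n x y = 0) : serre t n (k * x) (l * y) = 0 := by
  rw [serre_eq_iterComm ht] at h ⊢
  obtain ⟨⟨κ, h1⟩, -⟩ := iterComm_twist
    (fun s => ((t ^ (2 * (s : ℤ) - n + 1) : ℝ) : ℂ)) x y k l u w hkl hxk hxl hyk n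
  rw [h1, h, mul_zero, smul_zero]

/-- Antimultiplicative maps that are linear over the real scalars preserve the Serre expression
up to sign. -/
theorem serre_anti {B : Type*} [Ring B] [Algebra ℂ B] (φ : A →+ B)
    (hmul : ∀ x y, φ (x * y) = φ y * φ x) (hone : φ 1 = 1)
    (hreal : ∀ (r : ℝ) x, φ ((r : ℂ) • x) = (r : ℂ) • φ x) (t : ℝ) (n : ℕ) (x y : A) :
    serre t n (φ x) (φ y) = ((-1 : ℂ) ^ n) • φ (serre t n x y) := by
  have hpow : ∀ (x : A) (m : ℕ), φ (x ^ m) = φ x ^ m := by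
    intro x m
    induction m with
    | zero => simpa using hone
    | succ m ih => rw [pow_succ, hmul, ih, pow_succ']
  simp only [serre]
  rw [← Finset.sum_range_reflect, map_sum, Finset.smul_sum]
  refine Finset.sum_congr rfl fun r hr => ?_
  have hr := Finset.mem_range.1 hr
  have e1 : n + 1 - 1 - r = n - r := by omega
  have e2 : n - (n - r) = r := by omega
  rw [e1, e2, qBinom_symm t (by omega), hreal, smul_smul, hmul, hmul, hpow, hpow, ← mul_assoc]
  congr 1
  push_cast
  rw [← mul_assoc]
  congr 1
  obtain ⟨m, rfl⟩ : ∃ m, n = r + m := ⟨n - r, by omega⟩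
  rw [Nat.add_sub_cancel_left, pow_add, mul_right_comm, ← mul_pow]
  simp

end Serre

/-! ### The quantized enveloping algebra -/

/-- The numerical data defining a quantized enveloping algebra: a symmetrizable Cartan matrix
`a`, its symmetrizing numbers `d i = (α_i, α_i) / 2`, and a real deformation parameter `q`. -/
structure Datum (I : Type*) where
  a : I → I → ℤ
  d : I → ℝ
  q : ℝ
  q_pos : 0 < q
  q_ne_one : q ≠ 1
  a_self : ∀ i, a i i = 2
  a_nonpos : ∀ i j, i ≠ j → a i j ≤ 0
  d_pos : ∀ i, 0 < d i
  symm : ∀ i j, d i * a i j = d j * a j i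

/-- Generators of the quantized enveloping algebra. -/
inductive Gen (I : Type*) where
  | E : I → Gen I
  | F : I → Gen I
  | K : I → Gen I
  | Kinv : I → Gen I

variable {I : Type*}

namespace Datum

variable (D : Datum I)

/-- `q_i = q^(d_i)`. -/
def qi (i : I) : ℝ := D.q ^ D.d i

/-- `q_i^(a_ij) = q^((α_i, α_j))` -/
def qa (i j : I) : ℂ := ((D.qi i ^ D.a i j : ℝ) : ℂ)

/-- The exponent `1 - a_ij` of the quantum Serre relations, for `i ≠ j`. -/
def serreExp (i j : I) : ℕ := (1 - D.a i j).toNat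

theorem qi_pos (i : I) : 0 < D.qi i := Real.rpow_pos_of_pos D.q_pos _

theorem qa_ne_zero (i j : I) : D.qa i j ≠ 0 := by
  unfold qa
  exact_mod_cast (zpow_pos (D.qi_pos i) _).ne'

theorem qa_symm (i j : I) : D.qa i j = D.qa j i := by
  unfold qa qi
  congr 1
  rw [← Real.rpow_intCast, ← Real.rpow_intCast, ← Real.rpow_mul D.q_pos.le,
    ← Real.rpow_mul D.q_pos.le, D.symm]

theorem qa_self (i : I) : D.qa i i = ((D.qi i : ℝ) : ℂ) ^ 2 := by
  unfold qa
  rw [D.a_self]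
  norm_cast

theorem conj_qa (i j : I) : starRingEnd ℂ (D.qa i j) = D.qa i j := by
  simp only [qa, Complex.conj_ofReal]

theorem serreExp_cast {i j : I} (h : i ≠ j) : (D.serreExp i j : ℤ) = 1 - D.a i j := by
  have := D.a_nonpos i j h
  unfold serreExp
  omega

/-- The defining relations of the quantized enveloping algebra. -/
inductive Rel : FreeAlgebra ℂ (Gen I) → FreeAlgebra ℂ (Gen I) → Prop
  | K_Kinv (i : I) : Rel (FreeAlgebra.ι ℂ (Gen.K i) * FreeAlgebra.ι ℂ (Gen.Kinv i)) 1
  | Kinv_K (i : I) : Rel (FreeAlgebra.ι ℂ (Gen.Kinv i) * FreeAlgebra.ι ℂ (Gen.K i)) 1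
  | K_K (i j : I) : Rel (FreeAlgebra.ι ℂ (Gen.K i) * FreeAlgebra.ι ℂ (Gen.K j))
      (FreeAlgebra.ι ℂ (Gen.K j) * FreeAlgebra.ι ℂ (Gen.K i))
  | K_E (i j : I) : Rel
      (FreeAlgebra.ι ℂ (Gen.K i) * FreeAlgebra.ι ℂ (Gen.E j) * FreeAlgebra.ι ℂ (Gen.Kinv i))
      (D.qa i j • FreeAlgebra.ι ℂ (Gen.E j))
  | K_F (i j : I) : Rel
      (FreeAlgebra.ι ℂ (Gen.K i) * FreeAlgebra.ι ℂ (Gen.F j) * FreeAlgebra.ι ℂ (Gen.Kinv i))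
      ((D.qa i j)⁻¹ • FreeAlgebra.ι ℂ (Gen.F j))
  | E_F_self (i : I) : Rel
      (FreeAlgebra.ι ℂ (Gen.E i) * FreeAlgebra.ι ℂ (Gen.F i) -
        FreeAlgebra.ι ℂ (Gen.F i) * FreeAlgebra.ι ℂ (Gen.E i))
      (((D.qi i - (D.qi i)⁻¹ : ℝ) : ℂ)⁻¹ •
        (FreeAlgebra.ι ℂ (Gen.K i) - FreeAlgebra.ι ℂ (Gen.Kinv i)))
  | E_F_ne (i j : I) (h : i ≠ j) : Rel
      (FreeAlgebra.ι ℂ (Gen.E i) * FreeAlgebra.ι ℂ (Gen.F j) -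
        FreeAlgebra.ι ℂ (Gen.F j) * FreeAlgebra.ι ℂ (Gen.E i)) 0
  | serre_E (i j : I) (h : i ≠ j) : Rel
      (serre (D.qi i) (D.serreExp i j) (FreeAlgebra.ι ℂ (Gen.E i)) (FreeAlgebra.ι ℂ (Gen.E j))) 0
  | serre_F (i j : I) (h : i ≠ j) : Rel
      (serre (D.qi i) (D.serreExp i j) (FreeAlgebra.ι ℂ (Gen.F i)) (FreeAlgebra.ι ℂ (Gen.F j))) 0

/-- Elements of an algebra that satisfy the relations of the quantized enveloping algebra
(in a form without conjugation by `K_i`). -/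
structure Satisfies {A : Type*} [Ring A] [Algebra ℂ A] (e f k k' : I → A) : Prop where
  K_Kinv : ∀ i, k i * k' i = 1
  Kinv_K : ∀ i, k' i * k i = 1
  K_K : ∀ i j, k i * k j = k j * k i
  K_E : ∀ i j, k i * e j = D.qa i j • (e j * k i)
  K_F : ∀ i j, D.qa i j • (k i * f j) = f j * k i
  E_F_self : ∀ i, e i * f i - f i * e i = ((D.qi i - (D.qi i)⁻¹ : ℝ) : ℂ)⁻¹ • (k i - k' i)
  E_F_ne : ∀ i j, i ≠ j → e i * f j - f j * e i = 0
  serre_E : ∀ i j, i ≠ j → serre (D.qi i) (D.serreExp i j) (e i) (e j) = 0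
  serre_F : ∀ i j, i ≠ j → serre (D.qi i) (D.serreExp i j) (f i) (f j) = 0

end Datum

/-- The quantized enveloping algebra `U_q(𝔤)`: the algebra with generators
`E_i, F_i, K_i, K_i⁻¹` and the defining relations `Datum.Rel`. -/
def Uq (D : Datum I) : Type _ := RingQuot D.Rel

namespace Uq

variable {D : Datum I}

instance : Ring (Uq D) := inferInstanceAs (Ring (RingQuot D.Rel))

instance : Algebra ℂ (Uq D) := inferInstanceAs (Algebra ℂ (RingQuot D.Rel))

/-- The projection from the free algebra. -/
def mk (D : Datum I) : FreeAlgebra ℂ (Gen I) →ₐ[ℂ] Uq D := RingQuot.mkAlgHom ℂ D.Rel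

theorem mk_surjective : Function.Surjective (mk D) := RingQuot.mkAlgHom_surjective ℂ D.Rel

theorem mk_rel {x y : FreeAlgebra ℂ (Gen I)} (h : D.Rel x y) : mk D x = mk D y :=
  RingQuot.mkAlgHom_rel ℂ h

/-- The generator `E_i`. -/
def E (D : Datum I) (i : I) : Uq D := mk D (FreeAlgebra.ι ℂ (Gen.E i))
/-- The generator `F_i`. -/
def F (D : Datum I) (i : I) : Uq D := mk D (FreeAlgebra.ι ℂ (Gen.F i))
/-- The generator `K_i`. -/
def K (D : Datum I) (i : I) : Uq D := mk D (FreeAlgebra.ι ℂ (Gen.K i))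
/-- The generator `K_i⁻¹`. -/
def Kinv (D : Datum I) (i : I) : Uq D := mk D (FreeAlgebra.ι ℂ (Gen.Kinv i))

theorem induction {P : Uq D → Prop} (scalar : ∀ r, P (algebraMap ℂ (Uq D) r))
    (hE : ∀ i, P (E D i)) (hF : ∀ i, P (F D i)) (hK : ∀ i, P (K D i)) (hKinv : ∀ i, P (Kinv D i))
    (mul : ∀ x y, P x → P y → P (x * y)) (add : ∀ x y, P x → P y → P (x + y)) (x : Uq D) :
    P x := by
  obtain ⟨x, rfl⟩ := mk_surjective x
  induction x using FreeAlgebra.induction with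
  | grade0 r => rw [AlgHom.commutes]; exact scalar r
  | grade1 g => cases g with
    | E i => exact hE i
    | F i => exact hF i
    | K i => exact hK i
    | Kinv i => exact hKinv i
  | mul x y hx hy => rw [map_mul]; exact mul _ _ hx hy
  | add x y hx hy => rw [map_add]; exact add _ _ hx hy

theorem algHom_ext {A : Type*} [Ring A] [Algebra ℂ A] {f g : Uq D →ₐ[ℂ] A}
    (hE : ∀ i, f (E D i) = g (E D i)) (hF : ∀ i, f (F D i) = g (F D i))
    (hK : ∀ i, f (K D i) = g (K D i)) (hKinv : ∀ i, f (Kinv D i) = g (Kinv D i)) : f = g := by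
  ext x
  induction x using Uq.induction with
  | scalar r => simp
  | hE i => exact hE i
  | hF i => exact hF i
  | hK i => exact hK i
  | hKinv i => exact hKinv i
  | mul x y hx hy => rw [map_mul, map_mul, hx, hy]
  | add x y hx hy => rw [map_add, map_add, hx, hy]

theorem K_Kinv (i : I) : K D i * Kinv D i = 1 := by
  simpa [K, Kinv] using mk_rel (Datum.Rel.K_Kinv (D := D) i)

theorem Kinv_K (i : I) : Kinv D i * K D i = 1 := by
  simpa [K, Kinv] using mk_rel (Datum.Rel.Kinv_K (D := D) i)

theorem mul_Kinv_cancel (x : Uq D) (i : I) : x * K D i * Kinv D i = x := by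
  rw [mul_assoc, K_Kinv, mul_one]

theorem mul_K_cancel (x : Uq D) (i : I) : x * Kinv D i * K D i = x := by
  rw [mul_assoc, Kinv_K, mul_one]

theorem K_E (i j : I) : K D i * E D j = D.qa i j • (E D j * K D i) := by
  have h := mk_rel (Datum.Rel.K_E (D := D) i j)
  simp only [map_mul, map_smul] at h
  change K D i * E D j * Kinv D i = D.qa i j • E D j at h
  rw [← smul_mul_assoc, ← h, mul_K_cancel]

theorem K_F (i j : I) : D.qa i j • (K D i * F D j) = F D j * K D i := by
  have h := mk_rel (Datum.Rel.K_F (D := D) i j)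
  simp only [map_mul, map_smul] at h
  change K D i * F D j * Kinv D i = (D.qa i j)⁻¹ • F D j at h
  have h2 := congrArg (fun x => D.qa i j • (x * K D i)) h
  simp only [mul_K_cancel, smul_mul_assoc, smul_smul, mul_inv_cancel₀ (D.qa_ne_zero i j),
    one_smul] at h2
  exact h2

theorem satisfies (D : Datum I) : D.Satisfies (E D) (F D) (K D) (Kinv D) where
  K_Kinv := K_Kinv
  Kinv_K := Kinv_K
  K_K i j := by simpa [K] using mk_rel (Datum.Rel.K_K (D := D) i j)
  K_E := K_E
  K_F := K_F
  E_F_self i := by simpa [E, F, K, Kinv] using mk_rel (Datum.Rel.E_F_self (D := D) i)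
  E_F_ne i j h := by simpa [E, F] using mk_rel (Datum.Rel.E_F_ne (D := D) i j h)
  serre_E i j h := by simpa [E, map_serre] using mk_rel (Datum.Rel.serre_E (D := D) i j h)
  serre_F i j h := by simpa [F, map_serre] using mk_rel (Datum.Rel.serre_F (D := D) i j h)

end Uq

namespace Datum.Satisfies

variable {D : Datum I} {A : Type*} [Ring A] [Algebra ℂ A] {e f k k' : I → A}

theorem Kinv_E (h : D.Satisfies e f k k') (i j : I) : e j * k' i = D.qa i j • (k' i * e j) := by
  have h1 := congrArg (fun x => k' i * x * k' i) (h.K_E i j)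
  simp only [← mul_assoc, h.Kinv_K, one_mul, mul_smul_comm, smul_mul_assoc] at h1
  simpa only [mul_assoc, h.K_Kinv, mul_one] using h1

theorem Kinv_F (h : D.Satisfies e f k k') (i j : I) : D.qa i j • (f j * k' i) = k' i * f j := by
  have h1 := congrArg (fun x => k' i * x * k' i) (h.K_F i j)
  simp only [← mul_assoc, h.Kinv_K, one_mul, mul_smul_comm, smul_mul_assoc] at h1
  simpa only [mul_assoc, h.K_Kinv, mul_one] using h1

theorem K_Kinv_comm (h : D.Satisfies e f k k') (i j : I) : k i * k' j = k' j * k i := by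
  have h1 := congrArg (fun x => k' j * x * k' j) (h.K_K i j)
  simp only [← mul_assoc, h.Kinv_K, one_mul] at h1
  simp only [mul_assoc, h.K_Kinv, mul_one] at h1
  exact h1.symm

theorem Kinv_Kinv (h : D.Satisfies e f k k') (i j : I) : k' i * k' j = k' j * k' i := by
  have h1 := congrArg (fun x => k' i * x * k' i) (h.K_Kinv_comm i j)
  simp only [← mul_assoc, h.Kinv_K, one_mul] at h1
  simp only [mul_assoc, h.K_Kinv, mul_one] at h1
  exact h1.symm

end Datum.Satisfies

namespace Uq

variable {D : Datum I}

/-- The universal property of the quantized enveloping algebra. -/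
def lift {A : Type*} [Ring A] [Algebra ℂ A] {e f k k' : I → A} (h : D.Satisfies e f k k') :
    Uq D →ₐ[ℂ] A :=
  RingQuot.liftAlgHom ℂ ⟨FreeAlgebra.lift ℂ fun g => match g with
    | Gen.E i => e i
    | Gen.F i => f i
    | Gen.K i => k i
    | Gen.Kinv i => k' i, by
    intro x y hxy
    induction hxy with
    | K_Kinv i => simpa using h.K_Kinv i
    | Kinv_K i => simpa using h.Kinv_K i
    | K_K i j => simpa using h.K_K i j
    | K_E i j =>
      simp only [map_mul, map_smul, FreeAlgebra.lift_ι_apply]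
      rw [h.K_E, smul_mul_assoc, mul_assoc, h.K_Kinv, mul_one]
    | K_F i j =>
      simp only [map_mul, map_smul, FreeAlgebra.lift_ι_apply]
      rw [eq_inv_smul_iff₀ (D.qa_ne_zero i j), ← smul_mul_assoc, h.K_F, mul_assoc, h.K_Kinv,
        mul_one]
    | E_F_self i => simpa using h.E_F_self i
    | E_F_ne i j hij => simpa using h.E_F_ne i j hij
    | serre_E i j hij => simpa [map_serre] using h.serre_E i j hij
    | serre_F i j hij => simpa [map_serre] using h.serre_F i j hij⟩

section

variable {A : Type*} [Ring A] [Algebra ℂ A] {e f k k' : I → A} (h : D.Satisfies e f k k')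

@[simp] theorem lift_E (i : I) : lift h (E D i) = e i :=
  (RingQuot.liftAlgHom_mkAlgHom_apply ℂ _ _ _).trans (FreeAlgebra.lift_ι_apply _ _)

@[simp] theorem lift_F (i : I) : lift h (F D i) = f i :=
  (RingQuot.liftAlgHom_mkAlgHom_apply ℂ _ _ _).trans (FreeAlgebra.lift_ι_apply _ _)

@[simp] theorem lift_K (i : I) : lift h (K D i) = k i :=
  (RingQuot.liftAlgHom_mkAlgHom_apply ℂ _ _ _).trans (FreeAlgebra.lift_ι_apply _ _)

@[simp] theorem lift_Kinv (i : I) : lift h (Kinv D i) = k' i :=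
  (RingQuot.liftAlgHom_mkAlgHom_apply ℂ _ _ _).trans (FreeAlgebra.lift_ι_apply _ _)

end

/-! ### The Hopf algebra structure -/

theorem satisfies_counit (D : Datum I) :
    D.Satisfies (A := ℂ) (fun _ => 0) (fun _ => 0) (fun _ => 1) (fun _ => 1) where
  K_Kinv _ := by simp
  Kinv_K _ := by simp
  K_K _ _ := by simp
  K_E _ _ := by simp
  K_F _ _ := by simp
  E_F_self _ := by simp
  E_F_ne _ _ _ := by simp
  serre_E _ _ _ := serre_zero _ _ _
  serre_F _ _ _ := serre_zero _ _ _

/-- The counit `ε(K_i) = 1`, `ε(E_i) = ε(F_i) = 0`. -/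
def counitHom (D : Datum I) : Uq D →ₐ[ℂ] ℂ := lift (satisfies_counit D)

theorem serre_tmul_left (t : ℝ) (n : ℕ) (x y k l : Uq D) (hkl : k * l = l * k)
    (h : serre t n x y = 0) : serre t n (x ⊗ₜ[ℂ] k) (y ⊗ₜ[ℂ] l) = 0 := by
  have e : serre t n (x ⊗ₜ[ℂ] k) (y ⊗ₜ[ℂ] l) = serre t n x y ⊗ₜ[ℂ] (k ^ n * l) := by
    simp only [serre]
    rw [TensorProduct.sum_tmul]
    refine Finset.sum_congr rfl fun r hr => ?_
    have hr := Finset.mem_range.1 hr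
    simp only [Algebra.TensorProduct.tmul_pow, Algebra.TensorProduct.tmul_mul_tmul,
      TensorProduct.smul_tmul']
    congr 1
    have hc : Commute l (k ^ r) := (show Commute k l from hkl).symm.pow_right r
    rw [mul_assoc, hc.eq, ← mul_assoc (k ^ (n - r)), ← pow_add,
      Nat.sub_add_cancel (by omega)]
  rw [e, h, TensorProduct.zero_tmul]

theorem serre_tmul_right (t : ℝ) (n : ℕ) (x y k l : Uq D) (hkl : k * l = l * k)
    (h : serre t n x y = 0) : serre t n (k ⊗ₜ[ℂ] x) (l ⊗ₜ[ℂ] y) = 0 := by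
  have e : serre t n (k ⊗ₜ[ℂ] x) (l ⊗ₜ[ℂ] y) = (k ^ n * l) ⊗ₜ[ℂ] serre t n x y := by
    simp only [serre]
    rw [TensorProduct.tmul_sum]
    refine Finset.sum_congr rfl fun r hr => ?_
    have hr := Finset.mem_range.1 hr
    simp only [Algebra.TensorProduct.tmul_pow, Algebra.TensorProduct.tmul_mul_tmul,
      TensorProduct.tmul_smul]
    congr 2
    have hc : Commute l (k ^ r) := (show Commute k l from hkl).symm.pow_right r
    rw [mul_assoc, hc.eq, ← mul_assoc (k ^ (n - r)), ← pow_add,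
      Nat.sub_add_cancel (by omega)]
  rw [e, h, TensorProduct.tmul_zero]

theorem scalar_eq {i j : I} (hij : i ≠ j) (s : ℕ) :
    ((D.qi i ^ (2 * (s : ℤ) - D.serreExp i j + 1) : ℝ) : ℂ) =
      D.qa i j * ((D.qi i : ℂ) ^ 2) ^ s := by
  have h0 := (D.qi_pos i).ne'
  rw [D.serreExp_cast hij, show 2 * (s : ℤ) - (1 - D.a i j) + 1 = D.a i j + (2 * s : ℕ) by
    push_cast; ring, zpow_add₀ h0, zpow_natCast, pow_mul]
  simp [Datum.qa]

theorem scalar_eq' {i j : I} (hij : i ≠ j) (s : ℕ) :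
    ((D.qi i ^ (-(2 * (s : ℤ) - D.serreExp i j + 1)) : ℝ) : ℂ) =
      (D.qa i j)⁻¹ * (((D.qi i : ℂ) ^ 2)⁻¹) ^ s := by
  rw [zpow_neg, Complex.ofReal_inv, scalar_eq hij, mul_inv, inv_pow]

/-- Splitting of the Serre expression of sums of two families that commute up to scalars. -/
theorem serre_add_add {A : Type*} [Ring A] [Algebra ℂ A] {i j : I} (hij : i ≠ j)
    (x a y b : A) (hxa : a * x = (D.qi i : ℂ) ^ 2 • (x * a)) (hay : a * y = D.qa i j • (y * a))
    (hbx : b * x = D.qa i j • (x * b)) (hx : serre (D.qi i) (D.serreExp i j) x y = 0)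
    (ha : serre (D.qi i) (D.serreExp i j) a b = 0) :
    serre (D.qi i) (D.serreExp i j) (x + a) (y + b) = 0 := by
  have h0 : (D.qi i : ℂ) ^ 2 ≠ 0 := by
    have := (D.qi_pos i).ne'
    exact pow_ne_zero _ (by exact_mod_cast this)
  rw [serre_add_right]
  have h1 : serre (D.qi i) (D.serreExp i j) (x + a) y = 0 := by
    rw [serre_eq_iterComm (D.qi_pos i)] at hx ⊢
    rw [(iterComm_add _ x a y _ _ hxa hay (scalar_eq hij) _).1, hx]
  have h2 : serre (D.qi i) (D.serreExp i j) (x + a) b = 0 := by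
    rw [serre_eq_iterComm' (D.qi_pos i)] at ha ⊢
    rw [add_comm x a, (iterComm_add _ a x b ((D.qi i : ℂ) ^ 2)⁻¹ (D.qa i j)⁻¹ ?_ ?_
      (scalar_eq' hij) _).1, ha]
    · rw [hxa, smul_smul, inv_mul_cancel₀ h0, one_smul]
    · rw [hbx, smul_smul, inv_mul_cancel₀ (D.qa_ne_zero i j), one_smul]
  rw [h1, h2, add_zero]

theorem satisfies_comul (D : Datum I) :
    D.Satisfies (A := Uq D ⊗[ℂ] Uq D) (fun i => E D i ⊗ₜ K D i + 1 ⊗ₜ E D i)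
      (fun i => F D i ⊗ₜ 1 + Kinv D i ⊗ₜ F D i) (fun i => K D i ⊗ₜ K D i)
      (fun i => Kinv D i ⊗ₜ Kinv D i) := by
  have hs := satisfies D
  have cross : ∀ i j, (E D i * Kinv D j) ⊗ₜ[ℂ] (K D i * F D j) =
      (Kinv D j * E D i) ⊗ₜ[ℂ] (F D j * K D i) := by
    intro i j
    rw [hs.Kinv_E, ← hs.K_F, TensorProduct.smul_tmul, D.qa_symm]
  refine ⟨?_, ?_, ?_, ?_, ?_, ?_, ?_, ?_, ?_⟩
  · intro i
    simp [hs.K_Kinv, Algebra.TensorProduct.one_def]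
  · intro i
    simp [hs.Kinv_K, Algebra.TensorProduct.one_def]
  · intro i j
    simp [hs.K_K i j]
  · intro i j
    simp only [mul_add, add_mul, smul_add, Algebra.TensorProduct.tmul_mul_tmul, mul_one, one_mul]
    rw [hs.K_E, hs.K_K i j, TensorProduct.smul_tmul', TensorProduct.tmul_smul]
  · intro i j
    simp only [mul_add, add_mul, smul_add, Algebra.TensorProduct.tmul_mul_tmul, mul_one, one_mul]
    rw [← hs.K_F, hs.K_Kinv_comm i j, TensorProduct.smul_tmul', TensorProduct.tmul_smul]
  · intro i
    simp only [mul_add, add_mul, Algebra.TensorProduct.tmul_mul_tmul, mul_one, one_mul]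
    rw [cross i i]
    have h1 : (E D i * F D i) ⊗ₜ[ℂ] K D i - (F D i * E D i) ⊗ₜ[ℂ] K D i =
        ((D.qi i - (D.qi i)⁻¹ : ℝ) : ℂ)⁻¹ • ((K D i - Kinv D i) ⊗ₜ[ℂ] K D i) := by
      rw [← TensorProduct.sub_tmul, hs.E_F_self, TensorProduct.smul_tmul']
    have h2 : Kinv D i ⊗ₜ[ℂ] (E D i * F D i) - Kinv D i ⊗ₜ[ℂ] (F D i * E D i) =
        ((D.qi i - (D.qi i)⁻¹ : ℝ) : ℂ)⁻¹ • (Kinv D i ⊗ₜ[ℂ] (K D i - Kinv D i)) := by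
      rw [← TensorProduct.tmul_sub, hs.E_F_self, TensorProduct.tmul_smul]
    have h3 : K D i ⊗ₜ[ℂ] K D i - Kinv D i ⊗ₜ[ℂ] Kinv D i =
        (K D i - Kinv D i) ⊗ₜ[ℂ] K D i + Kinv D i ⊗ₜ[ℂ] (K D i - Kinv D i) := by
      rw [TensorProduct.sub_tmul, TensorProduct.tmul_sub]
      abel
    rw [h3, smul_add, ← h1, ← h2]
    abel
  · intro i j hij
    simp only [mul_add, add_mul, Algebra.TensorProduct.tmul_mul_tmul, mul_one, one_mul]
    rw [cross i j]
    have h1 : (E D i * F D j) ⊗ₜ[ℂ] K D i - (F D j * E D i) ⊗ₜ[ℂ] K D i = 0 := by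
      rw [← TensorProduct.sub_tmul, hs.E_F_ne i j hij, TensorProduct.zero_tmul]
    have h2 : Kinv D j ⊗ₜ[ℂ] (E D i * F D j) - Kinv D j ⊗ₜ[ℂ] (F D j * E D i) = 0 := by
      rw [← TensorProduct.tmul_sub, hs.E_F_ne i j hij, TensorProduct.tmul_zero]
    rw [← add_zero (0 : Uq D ⊗[ℂ] Uq D)]
    nth_rewrite 1 [← h1]
    rw [← h2]
    abel
  · intro i j hij
    rw [add_comm (E D i ⊗ₜ[ℂ] K D i), add_comm (E D j ⊗ₜ[ℂ] K D j)]
    refine serre_add_add hij _ _ _ _ ?_ ?_ ?_ ?_ ?_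
    · simp only [Algebra.TensorProduct.tmul_mul_tmul, mul_one, one_mul]
      rw [hs.K_E, TensorProduct.tmul_smul, D.qa_self]
    · simp only [Algebra.TensorProduct.tmul_mul_tmul, mul_one, one_mul]
      rw [hs.K_E, TensorProduct.tmul_smul]
    · simp only [Algebra.TensorProduct.tmul_mul_tmul, mul_one, one_mul]
      rw [hs.K_E, TensorProduct.tmul_smul, D.qa_symm]
    · exact serre_tmul_right _ _ _ _ _ _ rfl (hs.serre_E i j hij)
    · exact serre_tmul_left _ _ _ _ _ _ (hs.K_K i j) (hs.serre_E i j hij)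
  · intro i j hij
    refine serre_add_add hij _ _ _ _ ?_ ?_ ?_ ?_ ?_
    · simp only [Algebra.TensorProduct.tmul_mul_tmul, mul_one, one_mul]
      rw [← hs.Kinv_F, TensorProduct.smul_tmul', D.qa_self]
    · simp only [Algebra.TensorProduct.tmul_mul_tmul, mul_one, one_mul]
      rw [← hs.Kinv_F, TensorProduct.smul_tmul']
    · simp only [Algebra.TensorProduct.tmul_mul_tmul, mul_one, one_mul]
      rw [← hs.Kinv_F, TensorProduct.smul_tmul', D.qa_symm]
    · exact serre_tmul_left _ _ _ _ _ _ rfl (hs.serre_F i j hij)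
    · exact serre_tmul_right _ _ _ _ _ _ (hs.Kinv_Kinv i j) (hs.serre_F i j hij)

/-- The coproduct `Δ(K_i) = K_i ⊗ K_i`, `Δ(E_i) = E_i ⊗ K_i + 1 ⊗ E_i`,
`Δ(F_i) = F_i ⊗ 1 + K_i⁻¹ ⊗ F_i`. -/
def comulHom (D : Datum I) : Uq D →ₐ[ℂ] Uq D ⊗[ℂ] Uq D := lift (satisfies_comul D)

theorem serre_mul_Kinv {i j : I} (hij : i ≠ j) :
    serre (D.qi i) (D.serreExp i j) (E D i * Kinv D i) (E D j * Kinv D j) = 0 := by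
  have hs := satisfies D
  rw [hs.Kinv_E i i, hs.Kinv_E j j, ← smul_mul_assoc, ← smul_mul_assoc]
  refine serre_twist (D.qi_pos i) _ _ _ _ _ (D.qa i i) (D.qa i j) ?_ ?_ ?_ ?_
    (hs.serre_E i j hij)
  · simp only [smul_mul_assoc, mul_smul_comm]
    rw [hs.Kinv_Kinv i j, smul_comm]
  · rw [mul_smul_comm, hs.Kinv_E i i, smul_mul_assoc]
  · rw [mul_smul_comm, hs.Kinv_E j i, smul_mul_assoc, smul_comm, D.qa_symm j i]
  · rw [mul_smul_comm, hs.Kinv_E i j, smul_mul_assoc, smul_comm]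

theorem serre_K_mul {i j : I} (hij : i ≠ j) :
    serre (D.qi i) (D.serreExp i j) (K D i * F D i) (K D j * F D j) = 0 := by
  have hs := satisfies D
  refine serre_twist (D.qi_pos i) _ _ _ _ _ (D.qa i i) (D.qa i j) (hs.K_K i j) ?_ ?_ ?_
    (hs.serre_F i j hij)
  · rw [hs.K_F]
  · rw [D.qa_symm, hs.K_F]
  · rw [hs.K_F]

theorem serre_neg_neg {A : Type*} [Ring A] [Algebra ℂ A] {t : ℝ} (ht : 0 < t) (n : ℕ) (x y : A)
    (h : serre t n x y = 0) : serre t n (-x) (-y) = 0 := by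
  have := serre_twist ht n x y (-1) (-1) 1 1 rfl (by simp) (by simp) (by simp) h
  simpa using this

theorem E_Kinv_K_F (i j : I) :
    E D i * Kinv D i * (K D j * F D j) = K D j * (E D i * F D j) * Kinv D i := by
  have hs := satisfies D
  calc E D i * Kinv D i * (K D j * F D j)
      = E D i * (Kinv D i * K D j) * F D j := by simp only [mul_assoc]
    _ = E D i * K D j * (Kinv D i * F D j) := by rw [← hs.K_Kinv_comm j i]; simp only [mul_assoc]
    _ = (D.qa j i • (E D i * K D j)) * (F D j * Kinv D i) := by
        rw [← hs.Kinv_F i j, D.qa_symm, mul_smul_comm, smul_mul_assoc]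
    _ = K D j * (E D i * F D j) * Kinv D i := by rw [← hs.K_E]; simp only [mul_assoc]

theorem commutator_twist (i j : I) :
    E D i * Kinv D i * (K D j * F D j) - K D j * F D j * (E D i * Kinv D i) =
      K D j * (E D i * F D j - F D j * E D i) * Kinv D i := by
  rw [E_Kinv_K_F]
  simp only [mul_sub, sub_mul, mul_assoc]

theorem commutator_twist_self (i : I) :
    E D i * Kinv D i * (K D i * F D i) - K D i * F D i * (E D i * Kinv D i) =
      ((D.qi i - (D.qi i)⁻¹ : ℝ) : ℂ)⁻¹ • (K D i - Kinv D i) := by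
  have hs := satisfies D
  rw [commutator_twist, hs.E_F_self, mul_smul_comm, smul_mul_assoc, mul_sub, sub_mul,
    mul_Kinv_cancel, K_Kinv, one_mul]

theorem commutator_twist_ne (i j : I) (hij : i ≠ j) :
    E D i * Kinv D i * (K D j * F D j) - K D j * F D j * (E D i * Kinv D i) = 0 := by
  have hs := satisfies D
  rw [commutator_twist, hs.E_F_ne i j hij, mul_zero, zero_mul]

theorem E_Kinv_Kinv (i j : I) :
    E D j * Kinv D j * Kinv D i = D.qa i j • (Kinv D i * (E D j * Kinv D j)) := by
  have hs := satisfies D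
  rw [mul_assoc, hs.Kinv_Kinv j i, ← mul_assoc, hs.Kinv_E, smul_mul_assoc, mul_assoc]

theorem K_E_Kinv (i j : I) :
    K D i * (E D j * Kinv D j) = D.qa i j • (E D j * Kinv D j * K D i) := by
  have hs := satisfies D
  rw [← mul_assoc, hs.K_E, smul_mul_assoc, mul_assoc, hs.K_Kinv_comm, mul_assoc]

theorem K_F_K (i j : I) : K D j * F D j * K D i = D.qa i j • (K D i * (K D j * F D j)) := by
  have hs := satisfies D
  rw [mul_assoc, ← hs.K_F, mul_smul_comm, ← mul_assoc, hs.K_K j i, mul_assoc]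

theorem Kinv_K_F (i j : I) :
    Kinv D i * (K D j * F D j) = D.qa i j • (K D j * F D j * Kinv D i) := by
  have hs := satisfies D
  rw [← mul_assoc, ← hs.K_Kinv_comm, mul_assoc, ← hs.Kinv_F, mul_smul_comm, mul_assoc]

open MulOpposite in
theorem satisfies_antipode (D : Datum I) :
    D.Satisfies (A := (Uq D)ᵐᵒᵖ) (fun i => op (-(E D i * Kinv D i)))
      (fun i => op (-(K D i * F D i))) (fun i => op (Kinv D i)) (fun i => op (K D i)) := by
  have hs := satisfies D
  have hserre : ∀ (t : ℝ) (n : ℕ) (x y : Uq D),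
      serre t n (op x) (op y) = ((-1 : ℂ) ^ n) • op (serre t n x y) := fun t n x y =>
    serre_anti (opAddEquiv (α := Uq D)).toAddMonoidHom (fun _ _ => rfl) rfl (fun _ _ => rfl)
      t n x y
  refine ⟨?_, ?_, ?_, ?_, ?_, ?_, ?_, ?_, ?_⟩
  · intro i
    rw [← op_mul, K_Kinv, op_one]
  · intro i
    rw [← op_mul, Kinv_K, op_one]
  · intro i j
    rw [← op_mul, ← op_mul, hs.Kinv_Kinv]
  · intro i j
    rw [← op_mul, ← op_mul, ← op_smul, neg_mul, E_Kinv_Kinv, mul_neg, smul_neg]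
  · intro i j
    rw [← op_mul, ← op_mul, ← op_smul, mul_neg, Kinv_K_F, neg_mul, smul_neg]
  · intro i
    rw [← op_mul, ← op_mul, ← op_sub, ← op_sub, ← op_smul, neg_mul_neg, neg_mul_neg,
      ← neg_sub, commutator_twist_self, ← smul_neg, neg_sub]
  · intro i j hij
    rw [← op_mul, ← op_mul, ← op_sub, neg_mul_neg, neg_mul_neg, ← neg_sub,
      commutator_twist_ne i j hij, neg_zero, op_zero]
  · intro i j hij
    rw [hserre, serre_neg_neg (D.qi_pos i) _ _ _ (serre_mul_Kinv hij), op_zero, smul_zero]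
  · intro i j hij
    rw [hserre, serre_neg_neg (D.qi_pos i) _ _ _ (serre_K_mul hij), op_zero, smul_zero]

/-- The antipode `S(K_i) = K_i⁻¹`, `S(E_i) = -E_i K_i⁻¹`, `S(F_i) = -K_i F_i`, as an algebra
homomorphism to the opposite algebra. -/
def antipodeHom (D : Datum I) : Uq D →ₐ[ℂ] (Uq D)ᵐᵒᵖ := lift (satisfies_antipode D)

instance : Bialgebra ℂ (Uq D) :=
  Bialgebra.ofAlgHom (comulHom D) (counitHom D)
    (by
      refine algHom_ext ?_ ?_ ?_ ?_ <;> intro i <;>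
        simp [comulHom, TensorProduct.add_tmul, TensorProduct.tmul_add, add_assoc,
          Algebra.TensorProduct.one_def])
    (by
      refine algHom_ext ?_ ?_ ?_ ?_ <;> intro i <;>
        simp [comulHom, counitHom])
    (by
      refine algHom_ext ?_ ?_ ?_ ?_ <;> intro i <;>
        simp [comulHom, counitHom])

theorem comul_apply (x : Uq D) : Coalgebra.comul (R := ℂ) x = comulHom D x := rfl

theorem counit_apply (x : Uq D) : Coalgebra.counit (R := ℂ) x = counitHom D x := rfl

/-- The antipode as a linear map. -/
def antipodeLin (D : Datum I) : Uq D →ₗ[ℂ] Uq D :=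
  (MulOpposite.opLinearEquiv ℂ).symm.toLinearMap ∘ₗ (antipodeHom D).toLinearMap

theorem antipodeLin_mul (x y : Uq D) :
    antipodeLin D (x * y) = antipodeLin D y * antipodeLin D x := by
  simp [antipodeLin]

theorem antipodeLin_algebraMap (r : ℂ) :
    antipodeLin D (algebraMap ℂ (Uq D) r) = algebraMap ℂ (Uq D) r := by
  simp [antipodeLin]

@[simp] theorem antipodeLin_one : antipodeLin D 1 = 1 := by
  simpa using antipodeLin_algebraMap (D := D) 1

@[simp] theorem antipodeLin_E (i : I) : antipodeLin D (E D i) = -(E D i * Kinv D i) := by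
  simp [antipodeLin, antipodeHom]

@[simp] theorem antipodeLin_F (i : I) : antipodeLin D (F D i) = -(K D i * F D i) := by
  simp [antipodeLin, antipodeHom]

@[simp] theorem antipodeLin_K (i : I) : antipodeLin D (K D i) = Kinv D i := by
  simp [antipodeLin, antipodeHom]

@[simp] theorem antipodeLin_Kinv (i : I) : antipodeLin D (Kinv D i) = K D i := by
  simp [antipodeLin, antipodeHom]

theorem mul_antipode_left (x : Uq D) :
    LinearMap.mul' ℂ (Uq D) ((antipodeLin D).rTensor (Uq D) (comulHom D x)) =
      algebraMap ℂ (Uq D) (counitHom D x) := by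
  induction x using Uq.induction with
  | scalar r =>
    rw [AlgHom.commutes, AlgHom.commutes, Algebra.TensorProduct.algebraMap_apply]
    simp [antipodeLin_algebraMap]
  | hE i => simp [comulHom, counitHom, mul_assoc, Kinv_K]
  | hF i => simp [comulHom, counitHom]
  | hK i => simp [comulHom, counitHom, Kinv_K]
  | hKinv i => simp [comulHom, counitHom, K_Kinv]
  | add x y hx hy => simp only [map_add, hx, hy]
  | mul x y hx hy =>
    have key : ∀ z w : Uq D ⊗[ℂ] Uq D,
        LinearMap.mul' ℂ (Uq D) ((antipodeLin D).rTensor (Uq D) (z * w)) =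
        LinearMap.mul' ℂ (Uq D) ((antipodeLin D).rTensor (Uq D)
          ((1 ⊗ₜ LinearMap.mul' ℂ (Uq D) ((antipodeLin D).rTensor (Uq D) z)) * w)) := by
      intro z w
      induction z using TensorProduct.induction_on with
      | zero => simp
      | add z z' hz hz' =>
        simp only [add_mul, map_add, TensorProduct.tmul_add, hz, hz']
      | tmul a b =>
        induction w using TensorProduct.induction_on with
        | zero => simp
        | add w w' hw hw' => simp only [mul_add, map_add, hw, hw']
        | tmul c d => simp [antipodeLin_mul, mul_assoc]
    rw [map_mul, key, hx]
    have e : (1 : Uq D) ⊗ₜ[ℂ] algebraMap ℂ (Uq D) (counitHom D x) =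
        algebraMap ℂ (Uq D ⊗[ℂ] Uq D) (counitHom D x) := by
      rw [Algebra.TensorProduct.algebraMap_apply']
    rw [e, ← Algebra.smul_def, map_smul, map_smul, hy, map_mul, map_mul, Algebra.smul_def]

theorem mul_antipode_right (x : Uq D) :
    LinearMap.mul' ℂ (Uq D) ((antipodeLin D).lTensor (Uq D) (comulHom D x)) =
      algebraMap ℂ (Uq D) (counitHom D x) := by
  induction x using Uq.induction with
  | scalar r =>
    rw [AlgHom.commutes, AlgHom.commutes, Algebra.TensorProduct.algebraMap_apply]
    simp
  | hE i => simp [comulHom, counitHom]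
  | hF i => simp [comulHom, counitHom, ← mul_assoc, Kinv_K]
  | hK i => simp [comulHom, counitHom, K_Kinv]
  | hKinv i => simp [comulHom, counitHom, Kinv_K]
  | add x y hx hy => simp only [map_add, hx, hy]
  | mul x y hx hy =>
    have key : ∀ z w : Uq D ⊗[ℂ] Uq D,
        LinearMap.mul' ℂ (Uq D) ((antipodeLin D).lTensor (Uq D) (z * w)) =
        LinearMap.mul' ℂ (Uq D) ((antipodeLin D).lTensor (Uq D)
          (z * (LinearMap.mul' ℂ (Uq D) ((antipodeLin D).lTensor (Uq D) w) ⊗ₜ 1))) := by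
      intro z w
      induction w using TensorProduct.induction_on with
      | zero => simp
      | add w w' hw hw' =>
        simp only [mul_add, map_add, TensorProduct.add_tmul, hw, hw']
      | tmul c d =>
        induction z using TensorProduct.induction_on with
        | zero => simp
        | add z z' hz hz' => simp only [add_mul, map_add, hz, hz']
        | tmul a b => simp [antipodeLin_mul, mul_assoc]
    rw [map_mul, key, hy]
    have e : algebraMap ℂ (Uq D) (counitHom D y) ⊗ₜ[ℂ] (1 : Uq D) =
        algebraMap ℂ (Uq D ⊗[ℂ] Uq D) (counitHom D y) := by
      rw [Algebra.TensorProduct.algebraMap_apply]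
    rw [e, ← Algebra.commutes, ← Algebra.smul_def, map_smul, map_smul, hx, map_mul, map_mul,
      Algebra.smul_def, Algebra.commutes]

instance : HopfAlgebra ℂ (Uq D) where
  antipode := antipodeLin D
  mul_antipode_rTensor_comul := LinearMap.ext mul_antipode_left
  mul_antipode_lTensor_comul := LinearMap.ext mul_antipode_right

/-! ### The compact real form -/

/-- The opposite algebra with conjugated scalar multiplication. -/
def ConjOp (A : Type*) : Type _ := Aᵐᵒᵖ

namespace ConjOp

variable {A : Type*} [Ring A]

instance : Ring (ConjOp A) := inferInstanceAs (Ring Aᵐᵒᵖ)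

instance [Algebra ℂ A] : Algebra ℂ (ConjOp A) where
  smul c x := MulOpposite.op (starRingEnd ℂ c • MulOpposite.unop x)
  algebraMap := (algebraMap ℂ Aᵐᵒᵖ).comp (starRingEnd ℂ)
  commutes' c x := Algebra.commutes (A := Aᵐᵒᵖ) (starRingEnd ℂ c) x
  smul_def' c x := Algebra.smul_def (A := Aᵐᵒᵖ) (starRingEnd ℂ c) x

/-- The identity map to the conjugate opposite algebra. -/
def of : A ≃+ ConjOp A := MulOpposite.opAddEquiv

theorem of_mul (x y : A) : of (x * y) = of y * of x := rfl

theorem of_one : of (1 : A) = 1 := rfl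

theorem of_smul [Algebra ℂ A] (c : ℂ) (x : A) : of (c • x) = starRingEnd ℂ c • of x := by
  change MulOpposite.op (c • x) = MulOpposite.op (starRingEnd ℂ (starRingEnd ℂ c) • x)
  rw [Complex.conj_conj]

theorem of_smul_real [Algebra ℂ A] (r : ℝ) (x : A) : of ((r : ℂ) • x) = (r : ℂ) • of x := by
  rw [of_smul, Complex.conj_ofReal]

end ConjOp

open ConjOp in
theorem satisfies_star (D : Datum I) :
    D.Satisfies (A := ConjOp (Uq D)) (fun i => of (K D i * F D i))
      (fun i => of (E D i * Kinv D i)) (fun i => of (K D i)) (fun i => of (Kinv D i)) := by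
  have hs := satisfies D
  have hserre : ∀ (t : ℝ) (n : ℕ) (x y : Uq D),
      serre t n (of x) (of y) = ((-1 : ℂ) ^ n) • of (serre t n x y) := fun t n x y =>
    serre_anti (of (A := Uq D)).toAddMonoidHom of_mul of_one of_smul_real t n x y
  have hqa : ∀ i j (x : Uq D), D.qa i j • of x = of (D.qa i j • x) := by
    intro i j x
    rw [of_smul, D.conj_qa]
  refine ⟨?_, ?_, ?_, ?_, ?_, ?_, ?_, ?_, ?_⟩
  · intro i
    rw [← of_mul, Kinv_K, of_one]
  · intro i
    rw [← of_mul, K_Kinv, of_one]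
  · intro i j
    rw [← of_mul, ← of_mul, hs.K_K]
  · intro i j
    rw [← of_mul, ← of_mul, hqa, K_F_K]
  · intro i j
    rw [← of_mul, ← of_mul, hqa, K_E_Kinv]
  · intro i
    rw [← of_mul, ← of_mul, ← map_sub, ← map_sub, commutator_twist_self, of_smul]
    congr 1
    rw [map_inv₀, Complex.conj_ofReal]
  · intro i j hij
    rw [← of_mul, ← of_mul, ← map_sub, commutator_twist_ne j i hij.symm, map_zero]
  · intro i j hij
    rw [hserre, serre_K_mul hij, map_zero, smul_zero]
  · intro i j hij
    rw [hserre, serre_mul_Kinv hij, map_zero, smul_zero]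

/-- The compact real form, as a homomorphism to the conjugate opposite algebra. -/
def starHom (D : Datum I) : Uq D →ₐ[ℂ] ConjOp (Uq D) := lift (satisfies_star D)

/-- The compact real form `K_i^* = K_i`, `E_i^* = K_i F_i`, `F_i^* = E_i K_i⁻¹`, extended to a
conjugate-linear antimultiplicative map. -/
instance : Star (Uq D) := ⟨fun x => ConjOp.of.symm (starHom D x)⟩

theorem star_def (x : Uq D) : star x = ConjOp.of.symm (starHom D x) := rfl

theorem of_star (x : Uq D) : ConjOp.of (star x) = starHom D x := by
  rw [star_def, AddEquiv.apply_symm_apply]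

theorem star_mul' (x y : Uq D) : star (x * y) = star y * star x := by
  apply ConjOp.of.injective
  rw [of_star, ConjOp.of_mul, of_star, of_star, map_mul]

theorem star_add' (x y : Uq D) : star (x + y) = star x + star y := by
  simp only [star_def, map_add]

theorem star_smul' (c : ℂ) (x : Uq D) : star (c • x) = starRingEnd ℂ c • star x := by
  apply ConjOp.of.injective
  rw [of_star, ConjOp.of_smul, of_star, map_smul, Complex.conj_conj]

theorem star_E (i : I) : star (E D i) = K D i * F D i := by
  apply ConjOp.of.injective
  rw [of_star, starHom, lift_E]

theorem star_F (i : I) : star (F D i) = E D i * Kinv D i := by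
  apply ConjOp.of.injective
  rw [of_star, starHom, lift_F]

theorem star_K (i : I) : star (K D i) = K D i := by
  apply ConjOp.of.injective
  rw [of_star, starHom, lift_K]

theorem star_Kinv (i : I) : star (Kinv D i) = Kinv D i := by
  apply ConjOp.of.injective
  rw [of_star, starHom, lift_Kinv]

theorem star_scalar (r : ℂ) :
    star (algebraMap ℂ (Uq D) r) = algebraMap ℂ (Uq D) (starRingEnd ℂ r) := by
  have h1 : star (1 : Uq D) = 1 := by
    apply ConjOp.of.injective
    rw [of_star, map_one, ConjOp.of_one]
  rw [Algebra.algebraMap_eq_smul_one, Algebra.algebraMap_eq_smul_one, star_smul', h1]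

instance : StarRing (Uq D) where
  star_involutive x := by
    induction x using Uq.induction with
    | scalar r => rw [star_scalar, star_scalar, Complex.conj_conj]
    | hE i => rw [star_E, star_mul', star_F, star_K, mul_K_cancel]
    | hF i => rw [star_F, star_mul', star_E, star_Kinv, ← mul_assoc, Kinv_K, one_mul]
    | hK i => rw [star_K, star_K]
    | hKinv i => rw [star_Kinv, star_Kinv]
    | mul x y hx hy => rw [star_mul', star_mul', hx, hy]
    | add x y hx hy => rw [star_add', star_add', hx, hy]
  star_mul := star_mul'
  star_add := star_add'

instance : StarModule ℂ (Uq D) where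
  star_smul := star_smul'

end Uq

/-! ### The datum of a simple Lie algebra -/

section Lie

open LieAlgebra LieAlgebra.IsKilling Module

variable {𝔤 : Type*} [LieRing 𝔤] [LieAlgebra ℂ 𝔤] [FiniteDimensional ℂ 𝔤] [LieAlgebra.IsSimple ℂ 𝔤]
variable {H : LieSubalgebra ℂ 𝔤} [H.IsCartanSubalgebra]

/-- The bilinear form on `𝔥*` induced by the Killing form through the identification
`𝔥 ≃ 𝔥*` that it provides. -/
def killingDual (H : LieSubalgebra ℂ 𝔤) [H.IsCartanSubalgebra] (α β : Dual ℂ H) : ℂ :=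
  killingForm ℂ 𝔤 ((cartanEquivDual H).symm α : 𝔤) ((cartanEquivDual H).symm β : 𝔤)

theorem killingDual_eq (α β : Dual ℂ H) :
    killingDual H α β = α ((cartanEquivDual H).symm β) := by
  have h1 : cartanEquivDual H ((cartanEquivDual H).symm α) ((cartanEquivDual H).symm β) =
      α ((cartanEquivDual H).symm β) := by
    rw [LinearEquiv.apply_symm_apply]
  rw [← h1]
  rfl

theorem killingDual_comm (α β : Dual ℂ H) : killingDual H α β = killingDual H β α :=
  LieModule.traceForm_comm ℂ 𝔤 𝔤 _ _

theorem killingDual_mul_pairing (α β : H.root) :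
    killingDual H ((rootSystem H).root α) ((rootSystem H).root α) *
        ((rootSystem H).pairingIn ℤ β α : ℂ) =
      2 * killingDual H ((rootSystem H).root α) ((rootSystem H).root β) := by
  have h1 : (((rootSystem H).pairingIn ℤ β α : ℤ) : ℂ) = (rootSystem H).pairing β α := by
    rw [← (rootSystem H).algebraMap_pairingIn ℤ]; simp
  have h2 := root_apply_cartanEquivDual_symm_ne_zero (LieSubalgebra.isNonZero_coe_root α)
  rw [h1, killingDual_comm _ ((rootSystem H).root β), killingDual_eq, killingDual_eq,
    rootSystem_pairing_apply, coroot]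
  simp only [rootSystem_root_apply, map_smul, map_nsmul, smul_eq_mul, nsmul_eq_mul]
  simp only [LieModule.Weight.toLinear_apply]
  field_simp
  push_cast
  ring

theorem killingDual_self_pos (α : H.root) :
    0 < (killingDual H ((rootSystem H).root α) ((rootSystem H).root α)).re := by
  set t : H := (cartanEquivDual H).symm ((rootSystem H).root α) with ht
  set s : ℂ := killingDual H ((rootSystem H).root α) ((rootSystem H).root α) with hs
  have h0 : s ≠ 0 := by
    rw [hs, killingDual_eq]
    exact root_apply_cartanEquivDual_symm_ne_zero (LieSubalgebra.isNonZero_coe_root α)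
  have h1 : ∀ β : LieModule.Weight ℂ H 𝔤, ∃ r : ℝ, β t = (r : ℂ) * s := by
    intro β
    have h2 := apply_coroot_eq_cast (H := H) (K := ℂ) (L := 𝔤) α.1 β
    have h3 : s = α.1 ((cartanEquivDual H).symm α.1.toLinear) := by
      rw [hs, killingDual_eq]
      rfl
    rw [coroot] at h2
    generalize ((LieModule.chainBotCoeff (α.1 : H → ℂ) β : ℤ) -
      (LieModule.chainTopCoeff (α.1 : H → ℂ) β : ℤ)) = m at h2
    have h4 : β (2 • (s⁻¹ • t)) = (m : ℂ) := by
      rw [h3]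
      exact h2
    have h5 : 2 * (s⁻¹ * β t) = (m : ℂ) := by
      rw [← h4, ← LieModule.Weight.toLinear_apply, ← LieModule.Weight.toLinear_apply, map_nsmul,
        map_smul]
      simp
    refine ⟨m / 2, ?_⟩
    push_cast
    rw [← h5]
    field_simp
  choose r hr using h1
  have hsum : s = ((∑ β ∈ H.root, r β ^ 2 : ℝ) : ℂ) * s ^ 2 := by
    have h2 := congrArg (fun B => B t t) (restrict_killingForm_eq_sum (K := ℂ) (L := 𝔤) (H := H))
    change s = _ at h2
    conv_lhs => rw [h2]
    have hr' : ∀ β : LieModule.Weight ℂ H 𝔤, LieModule.Weight.toLinear ℂ H 𝔤 β t = (r β : ℂ) * s := hr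
    simp only [LinearMap.coe_sum, Finset.sum_apply, LinearMap.smulRight_apply, LinearMap.smul_apply,
      smul_eq_mul, hr']
    push_cast
    rw [Finset.sum_mul]
    exact Finset.sum_congr rfl fun β _ => by ring
  set R : ℝ := ∑ β ∈ H.root, r β ^ 2
  have hR : 0 ≤ R := Finset.sum_nonneg fun _ _ => sq_nonneg _
  have h6 : (R : ℂ) * s = 1 := by
    have : s * ((R : ℂ) * s) = s * 1 := by
      rw [mul_one]
      conv_rhs => rw [hsum]
      ring
    exact mul_left_cancel₀ h0 this
  have h7 : R * s.re = 1 := by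
    have := congrArg Complex.re h6
    simpa using this
  by_contra h
  nlinarith [mul_nonneg hR (neg_nonneg.2 (not_lt.1 h))]

variable (b : (rootSystem H).Base)

/-- The simple root with index `i`, as an element of `𝔥*`. -/
def simpleRoot (i : b.support) : Dual ℂ H := (rootSystem H).root i

/-- The invariant form `(α_i, α_j)` on simple roots: the form induced by the Killing form,
normalized so that `(α_i, α_i) = 2` for every short simple root. -/
def rootForm (i j : b.support) : ℝ :=
  2 * (killingDual H (simpleRoot b i) (simpleRoot b j)).re /
    ⨅ k : b.support, (killingDual H (simpleRoot b k) (simpleRoot b k)).re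

/-- The Cartan matrix in the convention `(α_i, α_j) = d_i a_ij` with `d_i = (α_i, α_i) / 2`, that
is `a_ij = ⟨α_j, α_i^∨⟩`. -/
def cartan (i j : b.support) : ℤ := b.cartanMatrix j i

theorem rootForm_eq (i j : b.support) : rootForm b i j = rootForm b i i / 2 * cartan b i j := by
  have h := congrArg Complex.re (killingDual_mul_pairing (H := H) i.1 j.1)
  rw [Complex.mul_re] at h
  simp only [Complex.intCast_re, Complex.intCast_im, mul_zero, sub_zero, Complex.mul_re,
    Complex.re_ofNat, Complex.im_ofNat, zero_mul] at h
  unfold rootForm simpleRoot cartan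
  rw [← h]
  change _ = _ * (((rootSystem H).pairingIn ℤ j.1 i.1 : ℤ) : ℝ)
  ring

theorem rootForm_comm (i j : b.support) : rootForm b i j = rootForm b j i := by
  unfold rootForm
  rw [killingDual_comm]

theorem rootForm_self_pos (i : b.support) : 0 < rootForm b i i := by
  unfold rootForm
  refine div_pos (mul_pos two_pos (killingDual_self_pos i.1)) ?_
  have : Nonempty b.support := ⟨i⟩
  obtain ⟨k, hk⟩ := exists_eq_ciInf_of_finite
    (f := fun k : b.support => (killingDual H (simpleRoot b k) (simpleRoot b k)).re)
  rw [← hk]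
  exact killingDual_self_pos k.1

/-- The datum of the quantized enveloping algebra `U_q(𝔤)`, for a simple Lie algebra `𝔤` with
Cartan subalgebra `𝔥`, base `b` of its root system, and real `q > 0`, `q ≠ 1`. -/
def lieDatum (q : ℝ) (hq0 : 0 < q) (hq1 : q ≠ 1) : Datum b.support where
  a := cartan b
  d i := rootForm b i i / 2
  q := q
  q_pos := hq0
  q_ne_one := hq1
  a_self i := b.cartanMatrix_apply_same i
  a_nonpos i j hij := b.cartanMatrix_le_zero_of_ne j i hij.symm
  d_pos i := half_pos (rootForm_self_pos b i)
  symm i j := by rw [← rootForm_eq, ← rootForm_eq, rootForm_comm]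

end Lie

/-! ### Representations -/

section Rep

open Module

variable {D : Datum I} {V : Type*} [AddCommGroup V] [Module ℂ V]

/-- The weight space of weight `μ`, where `μ i` is the integer `2 (μ, α_i) / (α_i, α_i)`: the
vectors on which `K_i` acts by `q^((μ, α_i)) = q_i^(μ i)`. -/
def weightSpace (ρ : Uq D →ₐ[ℂ] End ℂ V) (μ : I → ℤ) : Submodule ℂ V :=
  ⨅ i, LinearMap.ker (ρ (Uq.K D i) - ((D.qi i ^ μ i : ℝ) : ℂ) • LinearMap.id)

/-- Representations (of type 1) that are sums of their weight spaces. -/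
def IsTypeOne (ρ : Uq D →ₐ[ℂ] End ℂ V) : Prop :=
  ⨆ μ : I → ℤ, weightSpace ρ μ = ⊤

/-- `ρ` is the irreducible representation `V(Λ)` of highest weight `Λ`, where `Λ` is the dominant
integral weight with coefficients `Λ i` with respect to the fundamental weights. -/
structure IsHighestWeightIrrep (ρ : Uq D →ₐ[ℂ] End ℂ V) (Λ : I → ℕ) : Prop where
  irreducible : ∀ W : Submodule ℂ V, (∀ X, ∀ v ∈ W, ρ X v ∈ W) → W = ⊥ ∨ W = ⊤
  exists_highest : ∃ v : V, v ≠ 0 ∧ (∀ i, ρ (Uq.E D i) v = 0) ∧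
    v ∈ weightSpace ρ fun i => (Λ i : ℤ)

/-- The dual representation `(X ▷ f)(v) = f(S(X) ▷ v)`. -/
def dualRep (ρ : Uq D →ₐ[ℂ] End ℂ V) : Uq D →ₐ[ℂ] End ℂ (Dual ℂ V) :=
  AlgHom.ofLinearMap
    (Dual.transpose (R := ℂ) ∘ₗ ρ.toLinearMap ∘ₗ HopfAlgebra.antipode ℂ)
    (by
      ext f v
      change f (ρ (Uq.antipodeLin D 1) v) = f v
      rw [Uq.antipodeLin_one, map_one]
      rfl)
    (by
      intro X Y
      ext f v
      change f (ρ (Uq.antipodeLin D (X * Y)) v) = _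
      rw [Uq.antipodeLin_mul, map_mul]
      rfl)

theorem dualRep_apply (ρ : Uq D →ₐ[ℂ] End ℂ V) (X : Uq D) (f : Dual ℂ V) (v : V) :
    dualRep ρ X f v = f (ρ (HopfAlgebra.antipode ℂ X) v) := rfl

/-- The tensor product representation `X ▷ (v ⊗ w) = X₍₁₎ ▷ v ⊗ X₍₂₎ ▷ w`. -/
def tensorRep {W : Type*} [AddCommGroup W] [Module ℂ W] (ρ : Uq D →ₐ[ℂ] End ℂ V)
    (σ : Uq D →ₐ[ℂ] End ℂ W) : Uq D →ₐ[ℂ] End ℂ (V ⊗[ℂ] W) :=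
  (endTensorEndAlgHom (R := ℂ) (A := ℂ) (M := V) (N := W)).comp
    ((Algebra.TensorProduct.map ρ σ).comp (Bialgebra.comulAlgHom ℂ (Uq D)))

/-- The vector `w` is invariant under the subalgebra `𝒰`: `X ▷ w = ε(X) w` for `X ∈ 𝒰`. -/
def IsInvariantVector (ρ : Uq D →ₐ[ℂ] End ℂ V) (𝒰 : Subalgebra ℂ (Uq D)) (w : V) : Prop :=
  ∀ X ∈ 𝒰, ρ X w = (Coalgebra.counit X : ℂ) • w

/-- The inner product of `V` is compatible with the compact real form. -/
def IsUnitary {V : Type*} [NormedAddCommGroup V] [InnerProductSpace ℂ V]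
    (ρ : Uq D →ₐ[ℂ] End ℂ V) : Prop :=
  ∀ (X : Uq D) (v w : V), inner ℂ (ρ X v) w = inner ℂ v (ρ (star X) w)

/-- The matrix coefficient `c_{f,v}(X) = f(X ▷ v)`. -/
def matCoeff (ρ : Uq D →ₐ[ℂ] End ℂ V) (f : Dual ℂ V) (v : V) : Dual ℂ (Uq D) :=
  f ∘ₗ LinearMap.applyₗ v ∘ₗ ρ.toLinearMap

theorem matCoeff_apply (ρ : Uq D →ₐ[ℂ] End ℂ V) (f : Dual ℂ V) (v : V) (X : Uq D) :
    matCoeff ρ f v X = f (ρ X v) := rfl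

end Rep

/-! ### The quantized coordinate ring and generalized flag manifolds -/

section Coord

open Module

variable {D : Datum I}

/-- The product `(φ ψ)(X) = (φ ⊗ ψ)(Δ(X))` of the dual of `U_q(𝔤)`. -/
def dualMul (φ ψ : Dual ℂ (Uq D)) : Dual ℂ (Uq D) :=
  (WithConv.toConv φ * WithConv.toConv ψ).ofConv

/-- The star operation `φ^*(X) = conj (φ(S(X)^*))`. -/
def dualStar (φ : Dual ℂ (Uq D)) : Dual ℂ (Uq D) where
  toFun X := starRingEnd ℂ (φ (star (HopfAlgebra.antipode ℂ X)))
  map_add' X Y := by simp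
  map_smul' c X := by simp

/-- The left action `(X ▷ φ)(Y) = φ(Y X)`. -/
def leftAct (X : Uq D) (φ : Dual ℂ (Uq D)) : Dual ℂ (Uq D) := φ ∘ₗ LinearMap.mulRight ℂ X

/-- The right action `(φ ◁ X)(Y) = φ(X Y)`. -/
def rightAct (φ : Dual ℂ (Uq D)) (X : Uq D) : Dual ℂ (Uq D) := φ ∘ₗ LinearMap.mulLeft ℂ X

variable (D) in
/-- The quantized coordinate ring `ℂ_q[G]`: the span of the matrix coefficients of the
finite-dimensional representations (of type 1) of `U_q(𝔤)`. -/
def coordRing : Submodule ℂ (Dual ℂ (Uq D)) :=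
  Submodule.span ℂ {φ | ∃ (V : Type) (_ : AddCommGroup V) (_ : Module ℂ V)
    (_ : FiniteDimensional ℂ V) (ρ : Uq D →ₐ[ℂ] End ℂ V) (_ : IsTypeOne ρ) (f : Dual ℂ V) (v : V),
    φ = matCoeff ρ f v}

variable (D) in
/-- The quantized Levi factor `U_q(𝔩_S)`, generated by all `K_λ` (equivalently by all `K_i` and
`K_i⁻¹`) and by the `E_i`, `F_i` with `i ∈ S`. -/
def levi (S : Set I) : Subalgebra ℂ (Uq D) :=
  Algebra.adjoin ℂ (Set.range (Uq.K D) ∪ Set.range (Uq.Kinv D) ∪ Uq.E D '' S ∪ Uq.F D '' S)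

variable (D) in
/-- `ℂ_q[G / L_S]`, the elements of `ℂ_q[G]` with `X ▷ a = ε(X) a` for all `X ∈ U_q(𝔩_S)`. -/
def coordQuotRight (S : Set I) : Set (Dual ℂ (Uq D)) :=
  {a | a ∈ coordRing D ∧ ∀ X ∈ levi D S, leftAct X a = (Coalgebra.counit X : ℂ) • a}

variable (D) in
/-- `ℂ_q[L_S \ G]`, the elements of `ℂ_q[G]` with `a ◁ X = ε(X) a` for all `X ∈ U_q(𝔩_S)`. -/
def coordQuotLeft (S : Set I) : Set (Dual ℂ (Uq D)) :=
  {a | a ∈ coordRing D ∧ ∀ X ∈ levi D S, rightAct a X = (Coalgebra.counit X : ℂ) • a}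

variable {V : Type*} [NormedAddCommGroup V] [InnerProductSpace ℂ V]
  {ι : Type*} [Fintype ι]

/-- The dual basis `f^i` of an orthonormal basis `v_i`. -/
def dualVec (v : OrthonormalBasis ι ℂ V) (i : ι) : Dual ℂ V := v.toBasis.coord i

/-- The matrix coefficients `u^i_j(X) = f^i(X ▷ v_j)`. -/
def coeffU (ρ : Uq D →ₐ[ℂ] End ℂ V) (v : OrthonormalBasis ι ℂ V) (i j : ι) : Dual ℂ (Uq D) :=
  matCoeff ρ (dualVec v i) (v j)

/-- The matrix `M^n_m` with entries `(M^n_m)^i_j = (u^m_i)^* u^n_j`. -/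
def matM (ρ : Uq D →ₐ[ℂ] End ℂ V) (v : OrthonormalBasis ι ℂ V) (n m : ι) :
    Matrix ι ι (Dual ℂ (Uq D)) :=
  Matrix.of fun i j => dualMul (dualStar (coeffU ρ v m i)) (coeffU ρ v n j)

/-- The matrix `N^n_m` with entries `(N^n_m)^i_j = u^i_m (u^j_n)^*`. -/
def matN (ρ : Uq D →ₐ[ℂ] End ℂ V) (v : OrthonormalBasis ι ℂ V) (n m : ι) :
    Matrix ι ι (Dual ℂ (Uq D)) :=
  Matrix.of fun i j => dualMul (coeffU ρ v i m) (dualStar (coeffU ρ v j n))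

/-- The matrix `P = ∑_{m,n} c^m_n M^n_m`, where `c m n` stands for `c^m_n`. -/
def matP (ρ : Uq D →ₐ[ℂ] End ℂ V) (v : OrthonormalBasis ι ℂ V) (c : ι → ι → ℂ) :
    Matrix ι ι (Dual ℂ (Uq D)) :=
  ∑ m, ∑ n, c m n • matM ρ v n m

/-- The matrix `Q = ∑_{m,n} c^m_n N^n_m`, where `c m n` stands for `c^m_n`. -/
def matQ (ρ : Uq D →ₐ[ℂ] End ℂ V) (v : OrthonormalBasis ι ℂ V) (c : ι → ι → ℂ) :
    Matrix ι ι (Dual ℂ (Uq D)) :=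
  ∑ m, ∑ n, c m n • matN ρ v n m

/-- The vector `w = ∑_{m,n} c^m_n v_m ⊗ f^n` of `V ⊗ V*`. -/
def vecW (v : OrthonormalBasis ι ℂ V) (c : ι → ι → ℂ) : V ⊗[ℂ] Dual ℂ V :=
  ∑ m, ∑ n, c m n • (v m ⊗ₜ[ℂ] dualVec v n)

end Coord

end QuantumFlag

end

/-!
Let `T : V → V` be the endomorphism `∑ c^m_n v_m ⊗ f^n` and put `ρ = V(Λ)`. Each of the three
conditions says that `T` commutes with `ρ(X)` for all `X ∈ U_q(𝔩_S)`.

Unitarity identifies `u^{m*}_i(X)` with `f^i(ρ(S(X)) v_m)`, so the matrices `P` and `Q` evaluate at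
`X` to `ρ(S(X₍₁₎)) T ρ(X₍₂₎)` and `ρ(X₍₁₎) T ρ(S(X₍₂₎))`; the latter is also `X ▷ w` under
`V ⊗ V* ≃ End V`. Since these are adjoint actions of `U_q(𝔤)`, invariance of the entries of `P` and
`Q` under `X` says that the corresponding expression at `X` is `ε(X) T`. In the convolution algebra
`Hom(U_q(𝔤), End V)` the two expressions are the conjugates `ρ⁻¹ * (ε T) * ρ` and
`ρ * (ε T) * ρ⁻¹` by the unit `ρ`, whose inverse is `ρ ∘ S`. As `U_q(𝔩_S)` is a subcoalgebra,
equations between convolution products may be multiplied by `ρ` or `ρ⁻¹` after restriction to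
`U_q(𝔩_S)`, so either of them equals `ε T` there if and only if `ρ * (ε T) = (ε T) * ρ` there.
-/

namespace QuantumFlag

open Coalgebra HopfAlgebra WithConv Module

section Convolution

variable {R C A : Type*} [CommSemiring R] [AddCommMonoid C] [Module R C] [Semiring A] [Algebra R A]

theorem tmul_mem_range_mapIncl {P Q : Submodule R C} {X Y : C} (hX : X ∈ P) (hY : Y ∈ Q) :
    X ⊗ₜ[R] Y ∈ LinearMap.range (TensorProduct.mapIncl P Q) :=
  ⟨⟨X, hX⟩ ⊗ₜ ⟨Y, hY⟩, rfl⟩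

section CoalgebraStruct

variable [CoalgebraStruct R C]

/-- A submodule `P` of a coalgebra is a subcoalgebra when `Δ(P)` lies in the image of `P ⊗ P`. -/
def IsSubcoalgebra (P : Submodule R C) : Prop :=
  ∀ X ∈ P, comul X ∈ LinearMap.range (TensorProduct.mapIncl P P)

theorem IsSubcoalgebra.eqOn_convMul {P : Submodule R C} (hP : IsSubcoalgebra P)
    {f f' g g' : WithConv (C →ₗ[R] A)} (hf : Set.EqOn f f' P) (hg : Set.EqOn g g' P) :
    Set.EqOn (f * g).ofConv (f' * g').ofConv P := by
  intro X hX
  obtain ⟨z, hz⟩ := hP X hX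
  have hf' : f.ofConv ∘ₗ P.subtype = f'.ofConv ∘ₗ P.subtype := LinearMap.ext fun x => hf x.2
  have hg' : g.ofConv ∘ₗ P.subtype = g'.ofConv ∘ₗ P.subtype := LinearMap.ext fun x => hg x.2
  simp only [LinearMap.convMul_apply, ← hz, TensorProduct.mapIncl, ← LinearMap.comp_apply,
    ← TensorProduct.map_comp, hf', hg']

/-- The map `X ↦ ε(X) T`, which represents the constant `T` in the convolution algebra. -/
noncomputable def convConst (R C : Type*) {A : Type*} [CommSemiring R] [AddCommMonoid C]
    [Module R C] [CoalgebraStruct R C] [Semiring A] [Algebra R A] (T : A) : WithConv (C →ₗ[R] A) :=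
  toConv ((counit (R := R) (A := C)).smulRight T)

@[simp] theorem convConst_apply (T : A) (X : C) : convConst R C T X = (counit X : R) • T := rfl

end CoalgebraStruct

variable [Coalgebra R C]

@[simp] theorem convMul_convConst_apply (f : WithConv (C →ₗ[R] A)) (T : A) (X : C) :
    (f * convConst R C T) X = f X * T := by
  have h := congrArg (LinearMap.mul' R A ∘ₗ TensorProduct.map f.ofConv (.toSpanSingleton R A T))
    (sum_tmul_counit_eq (ℛ R X))
  simpa [(ℛ R X).convMul_apply, -sum_tmul_counit_eq] using h

@[simp] theorem convConst_convMul_apply (T : A) (f : WithConv (C →ₗ[R] A)) (X : C) :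
    (convConst R C T * f) X = T * f X := by
  have h := congrArg (LinearMap.mul' R A ∘ₗ TensorProduct.map (.toSpanSingleton R A T) f.ofConv)
    (sum_counit_tmul_eq (ℛ R X))
  simpa [(ℛ R X).convMul_apply, -sum_counit_tmul_eq] using h

variable {P : Submodule R C} (hP : IsSubcoalgebra P) (u : (WithConv (C →ₗ[R] A))ˣ)
  {f g : WithConv (C →ₗ[R] A)}
include hP

theorem IsSubcoalgebra.eqOn_units_convMul_iff :
    Set.EqOn (u.val * f).ofConv (u.val * g).ofConv P ↔ Set.EqOn f g P := by
  refine ⟨fun h => ?_, hP.eqOn_convMul (Set.eqOn_refl _ _)⟩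
  simpa using hP.eqOn_convMul (Set.eqOn_refl u⁻¹.val.ofConv P) h

theorem IsSubcoalgebra.eqOn_convMul_units_iff :
    Set.EqOn (f * u.val).ofConv (g * u.val).ofConv P ↔ Set.EqOn f g P := by
  refine ⟨fun h => ?_, fun h => hP.eqOn_convMul h (Set.eqOn_refl _ _)⟩
  simpa using hP.eqOn_convMul h (Set.eqOn_refl u⁻¹.val.ofConv P)

end Convolution

theorem isSubcoalgebra_adjoin {R H : Type*} [CommSemiring R] [Semiring H] [Bialgebra R H]
    {s : Set H} (hs : ∀ X ∈ s, comul X ∈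
      LinearMap.range (TensorProduct.mapIncl (Algebra.adjoin R s).toSubmodule
        (Algebra.adjoin R s).toSubmodule)) :
    IsSubcoalgebra (Algebra.adjoin R s).toSubmodule :=
  let incl := (Algebra.adjoin R s).val
  have adjoin_le : Algebra.adjoin R s ≤
      (Algebra.TensorProduct.map incl incl).range.comap (Bialgebra.comulAlgHom R H) :=
    Algebra.adjoin_le hs
  fun _ hX => adjoin_le hX

section Adjoint

variable {R H A : Type*} [CommSemiring R] [Semiring H] [HopfAlgebra R H] [Semiring A] [Algebra R A]

/-- An algebra map `φ` from a Hopf algebra, as a unit of the convolution algebra with inverse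
`φ ∘ S`. -/
noncomputable def convUnit (φ : H →ₐ[R] A) : (WithConv (H →ₗ[R] A))ˣ where
  val := toConv φ.toLinearMap
  inv := toConv (φ.toLinearMap ∘ₗ antipode R)
  val_inv := by
    ext X
    simpa [(ℛ R X).convMul_apply] using congrArg φ (sum_mul_antipode_eq_algebraMap_counit (ℛ R X))
  inv_val := by
    ext X
    simpa [(ℛ R X).convMul_apply] using congrArg φ (sum_antipode_mul_eq_algebraMap_counit (ℛ R X))

/-- The left adjoint action `X ↦ φ(X₍₁₎) T φ(S(X₍₂₎))`. -/
noncomputable def leftAd (φ : H →ₐ[R] A) (T : A) : WithConv (H →ₗ[R] A) :=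
  (convUnit φ).val * convConst R H T * (convUnit φ)⁻¹.val

/-- The right adjoint action `X ↦ φ(S(X₍₁₎)) T φ(X₍₂₎)`. -/
noncomputable def rightAd (φ : H →ₐ[R] A) (T : A) : WithConv (H →ₗ[R] A) :=
  (convUnit φ)⁻¹.val * convConst R H T * (convUnit φ).val

variable (φ : H →ₐ[R] A) (T : A)

theorem leftAd_eq_sum {ι : Type*} {X : H} (r : Repr R X ι) :
    leftAd φ T X = ∑ k ∈ r.index, φ (r.left k) * T * φ (antipode R (r.right k)) := by
  rw [leftAd, r.convMul_apply]
  simp only [convMul_convConst_apply]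
  rfl

theorem rightAd_eq_sum {ι : Type*} {X : H} (r : Repr R X ι) :
    rightAd φ T X = ∑ k ∈ r.index, φ (antipode R (r.left k)) * T * φ (r.right k) := by
  rw [rightAd, r.convMul_apply]
  simp only [convMul_convConst_apply]
  rfl

@[simp] theorem leftAd_one : leftAd φ T 1 = T := by
  simp [leftAd, convUnit, Algebra.TensorProduct.one_def]

@[simp] theorem rightAd_one : rightAd φ T 1 = T := by
  simp [rightAd, convUnit, Algebra.TensorProduct.one_def]

theorem leftAd_smul (r : R) : leftAd φ (r • T) = r • leftAd φ T := by
  ext X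
  simp [leftAd_eq_sum φ _ (ℛ R X), Finset.smul_sum]

theorem rightAd_smul (r : R) : rightAd φ (r • T) = r • rightAd φ T := by
  ext X
  simp [rightAd_eq_sum φ _ (ℛ R X), Finset.smul_sum]

theorem leftAd_mul (X Y : H) :
    leftAd φ T (X * Y) = leftAd φ (leftAd φ T Y) X := by
  simp only [leftAd_eq_sum φ _ (ℛ R X), leftAd_eq_sum φ _ (ℛ R Y),
    leftAd_eq_sum φ _ ((ℛ R X).mul (ℛ R Y))]
  simp [Finset.sum_product, Finset.mul_sum, Finset.sum_mul, mul_assoc,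
    antipode_mul_antidistrib]

theorem rightAd_mul (X Y : H) :
    rightAd φ T (X * Y) = rightAd φ (rightAd φ T X) Y := by
  simp only [rightAd_eq_sum φ _ (ℛ R X), rightAd_eq_sum φ _ (ℛ R Y),
    rightAd_eq_sum φ _ ((ℛ R X).mul (ℛ R Y))]
  simp [Finset.sum_product_right, Finset.mul_sum, Finset.sum_mul, mul_assoc,
    antipode_mul_antidistrib]

variable {φ T}

theorem forall_leftAd_mul_eq_iff {X : H} :
    (∀ Y, leftAd φ T (Y * X) = (counit X : R) • leftAd φ T Y) ↔
      leftAd φ T X = (counit X : R) • T := by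
  refine ⟨fun h => by simpa using h 1, fun h Y => ?_⟩
  rw [leftAd_mul, h, leftAd_smul, ofConv_smul, LinearMap.smul_apply]

theorem forall_rightAd_mul_eq_iff {X : H} :
    (∀ Y, rightAd φ T (X * Y) = (counit X : R) • rightAd φ T Y) ↔
      rightAd φ T X = (counit X : R) • T := by
  refine ⟨fun h => by simpa using h 1, fun h Y => ?_⟩
  rw [rightAd_mul, h, rightAd_smul, ofConv_smul, LinearMap.smul_apply]

theorem IsSubcoalgebra.leftAd_eqOn_convConst_iff {P : Submodule R H} (hP : IsSubcoalgebra P) :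
    Set.EqOn (leftAd φ T) (convConst R H T) P ↔ ∀ X ∈ P, Commute (φ X) T := by
  rw [← hP.eqOn_convMul_units_iff (convUnit φ), leftAd, Units.inv_mul_cancel_right]
  refine forall₂_congr fun X _ => ?_
  rw [convMul_convConst_apply, convConst_convMul_apply]
  rfl

theorem IsSubcoalgebra.rightAd_eqOn_convConst_iff {P : Submodule R H}
    (hP : IsSubcoalgebra P) :
    Set.EqOn (rightAd φ T) (convConst R H T) P ↔ ∀ X ∈ P, Commute (φ X) T := by
  rw [← hP.eqOn_units_convMul_iff (convUnit φ), rightAd, mul_assoc, Units.mul_inv_cancel_left]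
  refine forall₂_congr fun X _ => ?_
  rw [convMul_convConst_apply, convConst_convMul_apply]
  exact eq_comm

end Adjoint

variable {I : Type*} {D : Datum I}

theorem isSubcoalgebra_levi (S : Set I) : IsSubcoalgebra (Subalgebra.toSubmodule (levi D S)) := by
  refine isSubcoalgebra_adjoin fun X hX => ?_
  have mem_levi {X : Uq D} (hX : X ∈ Set.range (Uq.K D) ∪ Set.range (Uq.Kinv D) ∪ Uq.E D '' S ∪
      Uq.F D '' S) : X ∈ levi D S := Algebra.subset_adjoin hX
  have K_mem (i : I) : Uq.K D i ∈ levi D S := mem_levi (by simp)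
  have Kinv_mem (i : I) : Uq.Kinv D i ∈ levi D S := mem_levi (by simp)
  rcases hX with ((⟨i, rfl⟩ | ⟨i, rfl⟩) | ⟨i, hi, rfl⟩) | ⟨i, hi, rfl⟩ <;>
    simp only [Uq.comul_apply, Uq.comulHom, Uq.lift_K, Uq.lift_Kinv, Uq.lift_E, Uq.lift_F]
  · exact tmul_mem_range_mapIncl (K_mem i) (K_mem i)
  · exact tmul_mem_range_mapIncl (Kinv_mem i) (Kinv_mem i)
  · have E_mem : Uq.E D i ∈ levi D S := mem_levi (.inl (.inr ⟨i, hi, rfl⟩))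
    exact Submodule.add_mem _ (tmul_mem_range_mapIncl E_mem (K_mem i))
      (tmul_mem_range_mapIncl (one_mem (levi D S)) E_mem)
  · have F_mem : Uq.F D i ∈ levi D S := mem_levi (.inr ⟨i, hi, rfl⟩)
    exact Submodule.add_mem _ (tmul_mem_range_mapIncl F_mem (one_mem (levi D S)))
      (tmul_mem_range_mapIncl (Kinv_mem i) F_mem)

section Weights

variable {V W : Type*} [AddCommGroup V] [Module ℂ V] [AddCommGroup W] [Module ℂ W]
  {ρ : Uq D →ₐ[ℂ] End ℂ V} {σ : Uq D →ₐ[ℂ] End ℂ W}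

theorem mem_weightSpace {μ : I → ℤ} {x : V} :
    x ∈ weightSpace ρ μ ↔ ∀ i, ρ (Uq.K D i) x = ((D.qi i ^ μ i : ℝ) : ℂ) • x := by
  simp [weightSpace, sub_eq_zero]

theorem Kinv_apply_of_mem_weightSpace {μ : I → ℤ} {x : V} (hx : x ∈ weightSpace ρ μ) (i : I) :
    ρ (Uq.Kinv D i) x = ((D.qi i ^ (-μ i) : ℝ) : ℂ) • x := by
  have qi_zpow_ne_zero : ((D.qi i ^ μ i : ℝ) : ℂ) ≠ 0 :=
    Complex.ofReal_ne_zero.2 (zpow_pos (D.qi_pos i) _).ne'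
  have Kinv_K_apply : ρ (Uq.Kinv D i) (ρ (Uq.K D i) x) = x := by
    rw [← End.mul_apply, ← map_mul, Uq.Kinv_K, map_one, End.one_apply]
  rw [mem_weightSpace.1 hx, map_smul] at Kinv_K_apply
  rw [zpow_neg, Complex.ofReal_inv, eq_inv_smul_iff₀ qi_zpow_ne_zero, Kinv_K_apply]

theorem E_apply_mem_weightSpace {μ : I → ℤ} {x : V} (hx : x ∈ weightSpace ρ μ) (j : I) :
    ρ (Uq.E D j) x ∈ weightSpace ρ fun i => μ i + D.a i j := by
  refine mem_weightSpace.2 fun i => ?_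
  rw [← End.mul_apply, ← map_mul, Uq.K_E, map_smul, map_mul, LinearMap.smul_apply,
    End.mul_apply, mem_weightSpace.1 hx, map_smul, smul_smul, Datum.qa,
    ← Complex.ofReal_mul, ← zpow_add₀ (D.qi_pos i).ne', add_comm]

theorem F_apply_mem_weightSpace {μ : I → ℤ} {x : V} (hx : x ∈ weightSpace ρ μ) (j : I) :
    ρ (Uq.F D j) x ∈ weightSpace ρ fun i => μ i - D.a i j := by
  refine mem_weightSpace.2 fun i => ?_
  have h := congrArg (fun X => ρ X x) (Uq.K_F (D := D) i j)
  simp only [map_smul, map_mul, LinearMap.smul_apply, End.mul_apply, mem_weightSpace.1 hx] at h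
  rw [← eq_inv_smul_iff₀ (D.qa_ne_zero i j), smul_smul, Datum.qa, ← Complex.ofReal_inv,
    ← Complex.ofReal_mul, ← zpow_neg, ← zpow_add₀ (D.qi_pos i).ne'] at h
  rw [h, neg_add_eq_sub]

theorem map_iSup_weightSpace_le (ρ : Uq D →ₐ[ℂ] End ℂ V) (X : Uq D) :
    (⨆ μ, weightSpace ρ μ).map (ρ X) ≤ ⨆ μ, weightSpace ρ μ := by
  induction X using Uq.induction with
  | scalar r =>
    rintro _ ⟨x, hx, rfl⟩
    rw [AlgHom.commutes, algebraMap_end_apply]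
    exact Submodule.smul_mem _ _ hx
  | hE i =>
    rw [Submodule.map_iSup]
    exact iSup_le fun μ => le_iSup_of_le _ (Submodule.map_le_iff_le_comap.2 fun x hx =>
      E_apply_mem_weightSpace hx i)
  | hF i =>
    rw [Submodule.map_iSup]
    exact iSup_le fun μ => le_iSup_of_le _ (Submodule.map_le_iff_le_comap.2 fun x hx =>
      F_apply_mem_weightSpace hx i)
  | hK i =>
    rw [Submodule.map_iSup]
    refine iSup_mono fun μ => Submodule.map_le_iff_le_comap.2 fun x hx => ?_
    rw [Submodule.mem_comap, mem_weightSpace.1 hx]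
    exact Submodule.smul_mem _ _ hx
  | hKinv i =>
    rw [Submodule.map_iSup]
    refine iSup_mono fun μ => Submodule.map_le_iff_le_comap.2 fun x hx => ?_
    rw [Submodule.mem_comap, Kinv_apply_of_mem_weightSpace hx]
    exact Submodule.smul_mem _ _ hx
  | mul X Y hX hY =>
    rw [map_mul, End.mul_eq_comp, Submodule.map_comp]
    exact (Submodule.map_mono hY).trans hX
  | add X Y hX hY =>
    rw [map_add]
    exact (Submodule.map_add_le _ _ _).trans (sup_le hX hY)

theorem IsHighestWeightIrrep.isTypeOne {Λ : I → ℕ} (h : IsHighestWeightIrrep ρ Λ) :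
    IsTypeOne ρ := by
  refine (h.irreducible _ fun X x hx =>
    map_iSup_weightSpace_le ρ X (Submodule.mem_map_of_mem hx)).resolve_left fun hbot => ?_
  obtain ⟨x, hx0, -, hx⟩ := h.exists_highest
  exact hx0 (by simpa [hbot] using Submodule.mem_iSup_of_mem _ hx)

theorem isTypeOne_of_basis {κ : Type*} (b : Basis κ ℂ V) {μ : κ → I → ℤ}
    (hb : ∀ k, b k ∈ weightSpace ρ (μ k)) : IsTypeOne ρ := by
  rw [IsTypeOne, eq_top_iff, ← b.span_eq, Submodule.span_le, Set.range_subset_iff]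
  exact fun k => Submodule.mem_iSup_of_mem _ (hb k)

theorem IsTypeOne.exists_basis (hρ : IsTypeOne ρ) :
    ∃ (s : Set V) (b : Basis s ℂ V) (μ : s → I → ℤ), ∀ k, b k ∈ weightSpace ρ (μ k) := by
  have top_le_span : ⊤ ≤ Submodule.span ℂ (⋃ μ : I → ℤ, (weightSpace ρ μ : Set V)) := by
    rw [← Submodule.iSup_eq_span, hρ]
  have mem_weightSpace_ofSpan (k) : ∃ μ, Basis.ofSpan top_le_span k ∈ weightSpace ρ μ :=
    Set.mem_iUnion.1 (Basis.ofSpan_subset top_le_span (Set.mem_range_self k))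
  choose μ hμ using mem_weightSpace_ofSpan
  exact ⟨_, Basis.ofSpan top_le_span, μ, hμ⟩

theorem tensorRep_apply_eq_sum (ρ : Uq D →ₐ[ℂ] End ℂ V) (σ : Uq D →ₐ[ℂ] End ℂ W) {κ : Type*}
    {X : Uq D} (r : Repr ℂ X κ) : tensorRep ρ σ X =
      ∑ k ∈ r.index, TensorProduct.map (ρ (r.left k)) (σ (r.right k)) := by
  change endTensorEndAlgHom (Algebra.TensorProduct.map ρ σ (comul X)) = _
  simp only [← r.eq, map_sum, Algebra.TensorProduct.map_tmul, endTensorEndAlgHom_apply,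
    TensorProduct.AlgebraTensorModule.map_eq]

theorem tmul_mem_weightSpace_tensorRep {μ ν : I → ℤ} {x : V} {y : W} (hx : x ∈ weightSpace ρ μ)
    (hy : y ∈ weightSpace σ ν) : x ⊗ₜ y ∈ weightSpace (tensorRep ρ σ) (μ + ν) := by
  refine mem_weightSpace.2 fun i => ?_
  have K_apply : tensorRep ρ σ (Uq.K D i) (x ⊗ₜ y) = ρ (Uq.K D i) x ⊗ₜ σ (Uq.K D i) y := by
    change endTensorEndAlgHom (Algebra.TensorProduct.map ρ σ (Uq.comulHom D (Uq.K D i))) _ = _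
    rw [Uq.comulHom, Uq.lift_K]
    rfl
  rw [K_apply, mem_weightSpace.1 hx, mem_weightSpace.1 hy, TensorProduct.smul_tmul_smul,
    ← Complex.ofReal_mul, ← zpow_add₀ (D.qi_pos i).ne', Pi.add_apply]

theorem IsTypeOne.tensorRep (hρ : IsTypeOne ρ) (hσ : IsTypeOne σ) : IsTypeOne (tensorRep ρ σ) := by
  obtain ⟨s, b, μ, hb⟩ := hρ.exists_basis
  obtain ⟨t, b', ν, hb'⟩ := hσ.exists_basis
  refine isTypeOne_of_basis (b.tensorProduct b') (μ := fun k => μ k.1 + ν k.2) fun k => ?_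
  rw [Basis.tensorProduct_apply']
  exact tmul_mem_weightSpace_tensorRep (hb k.1) (hb' k.2)

theorem IsTypeOne.dualRep [FiniteDimensional ℂ V] (hρ : IsTypeOne ρ) : IsTypeOne (dualRep ρ) := by
  classical
  obtain ⟨s, b, μ, hb⟩ := hρ.exists_basis
  have : Finite s := Module.Finite.finite_basis b
  refine isTypeOne_of_basis b.dualBasis (μ := fun k => -μ k) fun k => mem_weightSpace.2 fun i => ?_
  refine b.ext fun l => ?_
  change b.dualBasis k (ρ (Uq.antipodeLin D (Uq.K D i)) (b l)) = (_ : ℂ) • b.dualBasis k (b l)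
  rw [Uq.antipodeLin_K, Kinv_apply_of_mem_weightSpace (hb l), map_smul, Basis.dualBasis_apply_self]
  split_ifs with h
  · rw [h, Pi.neg_apply]
  · rw [smul_zero, smul_zero]

end Weights

section CoordRing

variable {V W : Type*} [AddCommGroup V] [Module ℂ V] [AddCommGroup W] [Module ℂ W]
  {ρ : Uq D →ₐ[ℂ] End ℂ V} {σ : Uq D →ₐ[ℂ] End ℂ W}

-- `coordRing` only ranges over spaces in `Type`, so `V` is transported to `Fin n → ℂ`.
theorem matCoeff_mem_coordRing [FiniteDimensional ℂ V] (hρ : IsTypeOne ρ) (f : Dual ℂ V) (x : V) :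
    matCoeff ρ f x ∈ coordRing D := by
  let e : V ≃ₗ[ℂ] (Fin (finrank ℂ V) → ℂ) := (finBasis ℂ V).equivFun
  obtain ⟨s, b, μ, hb⟩ := hρ.exists_basis
  refine Submodule.subset_span ⟨Fin (finrank ℂ V) → ℂ, inferInstance, inferInstance, inferInstance,
    (e.conjAlgEquiv ℂ).toAlgHom.comp ρ, isTypeOne_of_basis (b.map e) (μ := μ) fun k =>
      mem_weightSpace.2 fun i => ?_, f ∘ₗ e.symm.toLinearMap, e x, ?_⟩
  · simp [mem_weightSpace.1 (hb k)]
  · ext X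
    simp [matCoeff_apply]

theorem dualMul_apply_eq_sum (φ ψ : Dual ℂ (Uq D)) {κ : Type*} {X : Uq D} (r : Repr ℂ X κ) :
    dualMul φ ψ X = ∑ k ∈ r.index, φ (r.left k) * ψ (r.right k) :=
  r.convMul_apply (toConv φ) (toConv ψ)

theorem dualMul_matCoeff (ρ : Uq D →ₐ[ℂ] End ℂ V) (σ : Uq D →ₐ[ℂ] End ℂ W) (f : Dual ℂ V) (x : V)
    (g : Dual ℂ W) (y : W) :
    dualMul (matCoeff ρ f x) (matCoeff σ g y) =
      matCoeff (tensorRep ρ σ) (TensorProduct.dualDistrib ℂ V W (f ⊗ₜ g)) (x ⊗ₜ y) := by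
  ext X
  simp [dualMul_apply_eq_sum _ _ (ℛ ℂ X), matCoeff_apply, tensorRep_apply_eq_sum ρ σ (ℛ ℂ X)]

theorem dualMul_matCoeff_mem_coordRing [FiniteDimensional ℂ V] [FiniteDimensional ℂ W]
    (hρ : IsTypeOne ρ) (hσ : IsTypeOne σ) (f : Dual ℂ V) (x : V) (g : Dual ℂ W) (y : W) :
    dualMul (matCoeff ρ f x) (matCoeff σ g y) ∈ coordRing D := by
  rw [dualMul_matCoeff]
  exact matCoeff_mem_coordRing (hρ.tensorRep hσ) _ _

end CoordRing

section Invariants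

section CommRing

variable {R V : Type*} [CommRing R] [AddCommGroup V] [Module R V]

/-- The endomorphism `y ↦ f(y) x` attached to `x ⊗ f`, extended linearly. -/
noncomputable def endOfTensor : V ⊗[R] Dual R V →ₗ[R] End R V :=
  dualTensorHom R V V ∘ₗ (TensorProduct.comm R V (Dual R V)).toLinearMap

@[simp] theorem endOfTensor_tmul_apply (x : V) (f : Dual R V) (y : V) :
    endOfTensor (x ⊗ₜ f) y = f y • x := by
  simp [endOfTensor]

theorem endOfTensor_injective [Module.Free R V] [Module.Finite R V] :
    Function.Injective (endOfTensor : V ⊗[R] Dual R V → End R V) :=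
  (dualTensorHomEquiv R V V).injective.comp (TensorProduct.comm R V (Dual R V)).injective

end CommRing

variable {V : Type*} [AddCommGroup V] [Module ℂ V]

theorem endOfTensor_map_dualRep (ρ : Uq D →ₐ[ℂ] End ℂ V) (A : End ℂ V) (X : Uq D)
    (w : V ⊗[ℂ] Dual ℂ V) :
    endOfTensor (TensorProduct.map A (dualRep ρ X) w) =
      A * endOfTensor w * ρ (antipode ℂ X) := by
  induction w with
  | zero => simp
  | add w w' hw hw' => simp [hw, hw', mul_add, add_mul]
  | tmul x f => ext y; simp [dualRep_apply]

theorem endOfTensor_tensorRep_dualRep (ρ : Uq D →ₐ[ℂ] End ℂ V) (X : Uq D)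
    (w : V ⊗[ℂ] Dual ℂ V) :
    endOfTensor (tensorRep ρ (dualRep ρ) X w) = leftAd ρ (endOfTensor w) X := by
  rw [tensorRep_apply_eq_sum ρ (dualRep ρ) (ℛ ℂ X), leftAd_eq_sum ρ _ (ℛ ℂ X)]
  simp only [LinearMap.sum_apply, map_sum, endOfTensor_map_dualRep]

theorem isInvariantVector_levi_iff_commute [FiniteDimensional ℂ V] (ρ : Uq D →ₐ[ℂ] End ℂ V)
    (S : Set I) (w : V ⊗[ℂ] Dual ℂ V) :
    IsInvariantVector (tensorRep ρ (dualRep ρ)) (levi D S) w ↔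
      ∀ X ∈ levi D S, Commute (ρ X) (endOfTensor w) := by
  refine Iff.trans (forall₂_congr fun X _ => ?_)
    (isSubcoalgebra_levi S).leftAd_eqOn_convConst_iff
  rw [← endOfTensor_injective.eq_iff, endOfTensor_tensorRep_dualRep, map_smul, convConst_apply]

end Invariants

section Matrices

variable {V : Type*} [NormedAddCommGroup V] [InnerProductSpace ℂ V] {ρ : Uq D →ₐ[ℂ] End ℂ V}
  {ι : Type*} [Fintype ι] (v : OrthonormalBasis ι ℂ V)

theorem dualVec_apply (i : ι) (x : V) : dualVec v i x = inner ℂ (v i) x := by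
  rw [dualVec, Basis.coord_apply, v.coe_toBasis_repr_apply, v.repr_apply_apply]

theorem end_ext_iff_dualVec {A B : End ℂ V} :
    A = B ↔ ∀ i j, dualVec v i (A (v j)) = dualVec v i (B (v j)) :=
  ⟨fun h _ _ => by rw [h], fun h => v.toBasis.ext fun j => v.toBasis.ext_elem fun i => by
    simpa [dualVec] using h i j⟩

theorem endOfTensor_vecW_apply (c : ι → ι → ℂ) (x : V) :
    endOfTensor (vecW v c) x = ∑ m, ∑ n, (c m n * dualVec v n x) • v m := by
  simp [vecW, mul_smul]

theorem dualStar_coeffU (hu : IsUnitary ρ) (m i : ι) :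
    dualStar (coeffU ρ v m i) = matCoeff (dualRep ρ) (Dual.eval ℂ V (v m)) (dualVec v i) := by
  ext X
  change starRingEnd ℂ (dualVec v m (ρ (star (antipode ℂ X)) (v i))) =
    dualVec v i (ρ (antipode ℂ X) (v m))
  rw [dualVec_apply, dualVec_apply, inner_conj_symm, hu, star_star]

theorem dualVec_mul_endOfTensor_vecW_mul (c : ι → ι → ℂ) (A B : End ℂ V) (i j : ι) :
    dualVec v i ((A * endOfTensor (vecW v c) * B) (v j)) =
      ∑ m, ∑ n, c m n * (dualVec v i (A (v m)) * dualVec v n (B (v j))) := by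
  simp only [End.mul_apply, endOfTensor_vecW_apply, map_sum, map_smul, smul_eq_mul, mul_assoc,
    mul_comm (dualVec v i _)]

theorem matP_apply (hu : IsUnitary ρ) (c : ι → ι → ℂ) (i j : ι) (X : Uq D) :
    matP ρ v c i j X = dualVec v i (rightAd ρ (endOfTensor (vecW v c)) X (v j)) := by
  have matM_apply (m n : ι) : matM ρ v n m i j X = ∑ k ∈ (ℛ ℂ X).index,
      dualVec v i (ρ (antipode ℂ ((ℛ ℂ X).left k)) (v m)) *
        dualVec v n (ρ ((ℛ ℂ X).right k) (v j)) := by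
    rw [matM, Matrix.of_apply, dualStar_coeffU v hu, dualMul_apply_eq_sum _ _ (ℛ ℂ X)]
    rfl
  simp only [matP, Matrix.sum_apply, Matrix.smul_apply, LinearMap.sum_apply, LinearMap.smul_apply,
    matM_apply, rightAd_eq_sum ρ _ (ℛ ℂ X), map_sum, dualVec_mul_endOfTensor_vecW_mul,
    smul_eq_mul, Finset.mul_sum]
  rw [Finset.sum_comm_cycle]

theorem matQ_apply (hu : IsUnitary ρ) (c : ι → ι → ℂ) (i j : ι) (X : Uq D) :
    matQ ρ v c i j X = dualVec v i (leftAd ρ (endOfTensor (vecW v c)) X (v j)) := by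
  have matN_apply (m n : ι) : matN ρ v n m i j X = ∑ k ∈ (ℛ ℂ X).index,
      dualVec v i (ρ ((ℛ ℂ X).left k) (v m)) *
        dualVec v n (ρ (antipode ℂ ((ℛ ℂ X).right k)) (v j)) := by
    rw [matN, Matrix.of_apply, dualStar_coeffU v hu, dualMul_apply_eq_sum _ _ (ℛ ℂ X)]
    rfl
  simp only [matQ, Matrix.sum_apply, Matrix.smul_apply, LinearMap.sum_apply, LinearMap.smul_apply,
    matN_apply, leftAd_eq_sum ρ _ (ℛ ℂ X), map_sum, dualVec_mul_endOfTensor_vecW_mul,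
    smul_eq_mul, Finset.mul_sum]
  rw [Finset.sum_comm_cycle]

theorem forall_rightAct_matP_eq_iff (hu : IsUnitary ρ) (c : ι → ι → ℂ) (X : Uq D) :
    (∀ i j, rightAct (matP ρ v c i j) X = (counit X : ℂ) • matP ρ v c i j) ↔
      rightAd ρ (endOfTensor (vecW v c)) X = (counit X : ℂ) • endOfTensor (vecW v c) := by
  have rightAct_matP_apply (i j : ι) (Y : Uq D) : rightAct (matP ρ v c i j) X Y =
      dualVec v i (rightAd ρ (endOfTensor (vecW v c)) (X * Y) (v j)) := matP_apply v hu c i j _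
  rw [← forall_rightAd_mul_eq_iff]
  simp only [LinearMap.ext_iff (M := Uq D), end_ext_iff_dualVec v, rightAct_matP_apply,
    LinearMap.smul_apply, map_smul, matP_apply v hu]
  exact ⟨fun h Y i j => h i j Y, fun h i j Y => h Y i j⟩

theorem forall_leftAct_matQ_eq_iff (hu : IsUnitary ρ) (c : ι → ι → ℂ) (X : Uq D) :
    (∀ i j, leftAct X (matQ ρ v c i j) = (counit X : ℂ) • matQ ρ v c i j) ↔
      leftAd ρ (endOfTensor (vecW v c)) X = (counit X : ℂ) • endOfTensor (vecW v c) := by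
  have leftAct_matQ_apply (i j : ι) (Y : Uq D) : leftAct X (matQ ρ v c i j) Y =
      dualVec v i (leftAd ρ (endOfTensor (vecW v c)) (Y * X) (v j)) := matQ_apply v hu c i j _
  rw [← forall_leftAd_mul_eq_iff]
  simp only [LinearMap.ext_iff (M := Uq D), end_ext_iff_dualVec v, leftAct_matQ_apply,
    LinearMap.smul_apply, map_smul, matQ_apply v hu]
  exact ⟨fun h Y i j => h i j Y, fun h i j Y => h Y i j⟩

theorem matP_mem_coordRing (hρ : IsTypeOne ρ) (hu : IsUnitary ρ) (c : ι → ι → ℂ) (i j : ι) :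
    matP ρ v c i j ∈ coordRing D := by
  have : FiniteDimensional ℂ V := v.toBasis.finiteDimensional_of_finite
  simp only [matP, matM, Matrix.sum_apply, Matrix.smul_apply, Matrix.of_apply,
    dualStar_coeffU v hu]
  exact Submodule.sum_mem _ fun m _ => Submodule.sum_mem _ fun n _ => Submodule.smul_mem _ _
    (dualMul_matCoeff_mem_coordRing hρ.dualRep hρ _ _ _ _)

theorem matQ_mem_coordRing (hρ : IsTypeOne ρ) (hu : IsUnitary ρ) (c : ι → ι → ℂ) (i j : ι) :
    matQ ρ v c i j ∈ coordRing D := by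
  have : FiniteDimensional ℂ V := v.toBasis.finiteDimensional_of_finite
  simp only [matQ, matN, Matrix.sum_apply, Matrix.smul_apply, Matrix.of_apply,
    dualStar_coeffU v hu]
  exact Submodule.sum_mem _ fun m _ => Submodule.sum_mem _ fun n _ => Submodule.smul_mem _ _
    (dualMul_matCoeff_mem_coordRing hρ hρ.dualRep _ _ _ _)

theorem forall_matP_mem_coordQuotLeft_iff_commute (hρ : IsTypeOne ρ) (hu : IsUnitary ρ)
    (c : ι → ι → ℂ) (S : Set I) :
    (∀ i j, matP ρ v c i j ∈ coordQuotLeft D S) ↔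
      ∀ X ∈ levi D S, Commute (ρ X) (endOfTensor (vecW v c)) := by
  refine Iff.trans ?_ (isSubcoalgebra_levi S).rightAd_eqOn_convConst_iff
  simp only [coordQuotLeft, Set.mem_ofPred_eq, matP_mem_coordRing v hρ hu, true_and]
  exact ⟨fun h X hX => (forall_rightAct_matP_eq_iff v hu c X).1 fun i j => h i j X hX,
    fun h i j X hX => (forall_rightAct_matP_eq_iff v hu c X).2 (h hX) i j⟩

theorem forall_matQ_mem_coordQuotRight_iff_commute (hρ : IsTypeOne ρ) (hu : IsUnitary ρ)
    (c : ι → ι → ℂ) (S : Set I) :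
    (∀ i j, matQ ρ v c i j ∈ coordQuotRight D S) ↔
      ∀ X ∈ levi D S, Commute (ρ X) (endOfTensor (vecW v c)) := by
  refine Iff.trans ?_ (isSubcoalgebra_levi S).leftAd_eqOn_convConst_iff
  simp only [coordQuotRight, Set.mem_ofPred_eq, matQ_mem_coordRing v hρ hu, true_and]
  exact ⟨fun h X hX => (forall_leftAct_matQ_eq_iff v hu c X).1 fun i j => h i j X hX,
    fun h i j X hX => (forall_leftAct_matQ_eq_iff v hu c X).2 (h hX) i j⟩

end Matrices

end QuantumFlag

open QuantumFlag in
theorem mainTheorem10_general {I : Type*} {D : Datum I}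
    {V : Type*} [NormedAddCommGroup V] [InnerProductSpace ℂ V]
    {ρ : Uq D →ₐ[ℂ] Module.End ℂ V} (hρ : IsTypeOne ρ) (hu : IsUnitary ρ)
    {ι : Type*} [Fintype ι] (v : OrthonormalBasis ι ℂ V) (c : ι → ι → ℂ) (S : Set I) :
    (((∀ i j, matP ρ v c i j ∈ coordQuotLeft D S) ∧ ∀ i j, matQ ρ v c i j ∈ coordQuotRight D S) ↔
      IsInvariantVector (tensorRep ρ (dualRep ρ)) (levi D S) (vecW v c)) ∧
    ((∀ i j, matP ρ v c i j ∈ coordQuotLeft D S) ↔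
      IsInvariantVector (tensorRep ρ (dualRep ρ)) (levi D S) (vecW v c)) ∧
    ((∀ i j, matQ ρ v c i j ∈ coordQuotRight D S) ↔
      IsInvariantVector (tensorRep ρ (dualRep ρ)) (levi D S) (vecW v c)) := by
  have : FiniteDimensional ℂ V := v.toBasis.finiteDimensional_of_finite
  simp only [forall_matP_mem_coordQuotLeft_iff_commute v hρ hu,
    forall_matQ_mem_coordQuotRight_iff_commute v hρ hu, isInvariantVector_levi_iff_commute,
    and_self]

theorem mainTheorem10
    {𝔤 : Type*} [LieRing 𝔤] [LieAlgebra ℂ 𝔤] [FiniteDimensional ℂ 𝔤] [LieAlgebra.IsSimple ℂ 𝔤]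
    (𝔥 : LieSubalgebra ℂ 𝔤) [𝔥.IsCartanSubalgebra]
    (b : (LieAlgebra.IsKilling.rootSystem 𝔥).Base)
    (q : ℝ) (hq0 : 0 < q) (hq1 : q ≠ 1)
    (Λ : b.support → ℕ)
    {V : Type*} [NormedAddCommGroup V] [InnerProductSpace ℂ V]
    (ρ : QuantumFlag.Uq (QuantumFlag.lieDatum b q hq0 hq1) →ₐ[ℂ] Module.End ℂ V)
    (hρΛ : QuantumFlag.IsHighestWeightIrrep ρ Λ)
    (hρ : QuantumFlag.IsUnitary ρ)
    {ι : Type*} [Fintype ι] (v : OrthonormalBasis ι ℂ V)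
    (c : ι → ι → ℂ)
    (S : Set b.support) :
    (((∀ i j, QuantumFlag.matP ρ v c i j ∈
          QuantumFlag.coordQuotLeft (QuantumFlag.lieDatum b q hq0 hq1) S) ∧
        (∀ i j, QuantumFlag.matQ ρ v c i j ∈
          QuantumFlag.coordQuotRight (QuantumFlag.lieDatum b q hq0 hq1) S)) ↔
      QuantumFlag.IsInvariantVector (QuantumFlag.tensorRep ρ (QuantumFlag.dualRep ρ))
        (QuantumFlag.levi (QuantumFlag.lieDatum b q hq0 hq1) S) (QuantumFlag.vecW v c)) ∧
    ((∀ i j, QuantumFlag.matP ρ v c i j ∈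
        QuantumFlag.coordQuotLeft (QuantumFlag.lieDatum b q hq0 hq1) S) ↔
      QuantumFlag.IsInvariantVector (QuantumFlag.tensorRep ρ (QuantumFlag.dualRep ρ))
        (QuantumFlag.levi (QuantumFlag.lieDatum b q hq0 hq1) S) (QuantumFlag.vecW v c)) ∧
    ((∀ i j, QuantumFlag.matQ ρ v c i j ∈
        QuantumFlag.coordQuotRight (QuantumFlag.lieDatum b q hq0 hq1) S) ↔
      QuantumFlag.IsInvariantVector (QuantumFlag.tensorRep ρ (QuantumFlag.dualRep ρ))
        (QuantumFlag.levi (QuantumFlag.lieDatum b q hq0 hq1) S) (QuantumFlag.vecW v c)) :=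
  mainTheorem10_general hρΛ.isTypeOne hρ v c S
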